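/- For a graph $G=(V,E)$, a decomposition into balanced complete bipartite graphs is a list of complete bipartite subgraphs $G_i=(A_i,B_i,E_i)$ of $G$, with $A_i\cap B_i=\emptyset$ and $|A_i|=|B_i|\ge 1$, whose edge sets $E_i$ partition $E$. Its complexity is $\sum_i(|A_i|+|B_i|)$. Algorithm FIND-BIPARTITE, on a graph with $n$ vertices and $m$ edges, puts $$q=\left\lfloor\frac{\ln(n/2)}{\ln(2en^2/m)}\right\rfloor,\qquad r=\left\lfloor\frac{qn^2}{m}\right\rfloor,$$ lets $R$ be a set of $r$ vertices of highest degree, and goes through the $q$-element subsets $C$ of $R$. For each it computes $D=\bigcap_{v\in C}(N(v)\setminus R)$; as soon as $|D|\ge q$ it returns $(C,D')$, where $D'$ consists of the first $q$ elements of $D$. Algorithm FIND-DECOMPOSITION with threshold $n_0$, on an $n$-vertex graph $G$: if $n<n_0$, it finds a decomposition of $G$ into balanced complete bipartite graphs of minimum complexity by brute force. Otherwise, as long as the current graph has more than $n^2/\ln n$ edges, it applies FIND-BIPARTITE to the current graph and deletes the edges of the complete bipartite graph found; after that, each remaining edge forms a separate bipartite graph $K_{1,1}$. Theorem. For every sufficiently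 large constant $n_0$ there are a constant $C$ and a polynomial $p$ such that for every $n$ and every $n$-vertex graph $G$, given by its adjacency matrix, Algorithm FIND-DECOMPOSITION with threshold $n_0$ returns a decomposition of $G$ into balanced complete bipartite graphs, the complexity of this decomposition is at most $C\,n^2/\ln n$ if $n\ge 2$, and the algorithm takes at most $p(n)$ elementary steps. (Reading and writing a matrix entry, elementary list operations, additions and comparisons of integers, and the evaluation of $q$, of $r$ and of the test $m>n^2/\ln n$ each count as one step.) -/

import Mathlib

namespace Biclique

/-! ### Decompositions into balanced complete bipartite graphs -/

/-- The edge set of the complete bipartite graph with parts `K.1` and `K.2`. -/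
def edges {V : Type*} (K : Finset V × Finset V) : Set (Sym2 V) :=
  {e | ∃ a ∈ K.1, ∃ b ∈ K.2, e = s(a, b)}

/-- The complete bipartite graphs listed in `L` are balanced (with non-empty, disjoint parts),
and their edge sets partition the edge set of `G`. In particular each is a subgraph of `G`. -/
structure IsBalancedDecomposition {V : Type*} (G : SimpleGraph V)
    (L : List (Finset V × Finset V)) : Prop where
  nonempty : ∀ K ∈ L, K.1.Nonempty
  disjoint_parts : ∀ K ∈ L, Disjoint K.1 K.2
  balanced : ∀ K ∈ L, K.1.card = K.2.card
  edge_disjoint : L.Pairwise fun K K' => Disjoint (edges K) (edges K')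
  cover : ∀ e : Sym2 V, e ∈ G.edgeSet ↔ ∃ K ∈ L, e ∈ edges K

/-- The complexity of a decomposition: the total number of vertices of its members. -/
def complexity {V : Type*} (L : List (Finset V × Finset V)) : ℕ :=
  (L.map fun K => K.1.card + K.2.card).sum

/-! ### The arithmetic parameters of the algorithm -/

/-- `q(n, m) = ⌊ln (n / 2) / ln (2 e n² / m)⌋`. -/
noncomputable def qParam (n m : ℕ) : ℕ :=
  ⌊Real.log ((n : ℝ) / 2) / Real.log (2 * Real.exp 1 * (n : ℝ) ^ 2 / (m : ℝ))⌋₊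

/-- `r(n, m) = ⌊q(n, m) n² / m⌋`. -/
noncomputable def rParam (n m : ℕ) : ℕ :=
  ⌊(qParam n m : ℝ) * (n : ℝ) ^ 2 / (m : ℝ)⌋₊

open Classical in
/-- The test `m > n² / ln n`. -/
noncomputable def isDense (n m : ℕ) : Bool :=
  decide ((n : ℝ) ^ 2 / Real.log (n : ℝ) < (m : ℝ))

/-! ### The model of computation

A first-order programming language. Its data are natural numbers, truth values, vertices of the
input graph, adjacency matrices with random access, lists and pairs; its only loop is the loop over
the entries of a list. A program is a syntax tree, `Expr.val` is the result of its evaluation, and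
`Expr.cost` is the number of elementary steps that this evaluation takes. -/

/-- The data types of the language. -/
inductive Ty : Type
  | nat
  | bool
  | vertex
  | matrix
  | list (a : Ty)
  | prod (a b : Ty)

/-- Programs with result of a given type. Program variables of type `a` are elements of `rep a`;
as programs are polymorphic in `rep`, they can use a variable in no way except through the
constructors below, all of which are charged for. -/
inductive Expr (rep : Ty → Type) : Ty → Type
  /-- the content of a variable -/
  | var {a : Ty} (x : rep a) : Expr rep a
  /-- evaluate `e` once, store the result in a new variable, and continue -/
  | letE {a b : Ty} (e : Expr rep a) (f : rep a → Expr rep b) : Expr rep b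
  /-- `if b then s else t`; only the chosen branch is evaluated -/
  | ite {a : Ty} (b : Expr rep .bool) (s t : Expr rep a) : Expr rep a
  | tt : Expr rep .bool
  | ff : Expr rep .bool
  | lit (k : ℕ) : Expr rep .nat
  | add (s t : Expr rep .nat) : Expr rep .nat
  | lt (s t : Expr rep .nat) : Expr rep .bool
  | eq (s t : Expr rep .nat) : Expr rep .bool
  /-- the list `0, 1, ..., k - 1` -/
  | range (k : Expr rep .nat) : Expr rep (.list .nat)
  /-- the list of all vertices of the input graph -/
  | vertices : Expr rep (.list .vertex)
  /-- the number of a vertex -/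
  | index (v : Expr rep .vertex) : Expr rep .nat
  /-- the entry of a matrix in row `u` and column `v` -/
  | read (M : Expr rep .matrix) (u v : Expr rep .vertex) : Expr rep .bool
  /-- the matrix after overwriting the entry in row `u` and column `v` by `b` -/
  | write (M : Expr rep .matrix) (u v : Expr rep .vertex) (b : Expr rep .bool) : Expr rep .matrix
  | nil {a : Ty} : Expr rep (.list a)
  | cons {a : Ty} (x : Expr rep a) (l : Expr rep (.list a)) : Expr rep (.list a)
  | pair {a b : Ty} (x : Expr rep a) (y : Expr rep b) : Expr rep (.prod a b)
  | fst {a b : Ty} (p : Expr rep (.prod a b)) : Expr rep a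
  | snd {a b : Ty} (p : Expr rep (.prod a b)) : Expr rep b
  /-- `s := init; for x in l do s := f s x; return s` -/
  | foldl {a s : Ty} (l : Expr rep (.list a)) (init : Expr rep s)
      (f : rep s → rep a → Expr rep s) : Expr rep s
  /-- the arithmetic expressions `q(n, m)`, `r(n, m)` and `m > n² / ln n` -/
  | q (n m : Expr rep .nat) : Expr rep .nat
  | r (n m : Expr rep .nat) : Expr rep .nat
  | dense (n m : Expr rep .nat) : Expr rep .bool

/-- The data of each type, for an input graph with vertex set `Fin n`. -/
@[reducible] def Den (n : ℕ) : Ty → Type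
  | .nat => ℕ
  | .bool => Bool
  | .vertex => Fin n
  | .matrix => Fin n → Fin n → Bool
  | .list a => List (Den n a)
  | .prod a b => Den n a × Den n b

/-- The result of evaluating an expression. -/
noncomputable def Expr.val {n : ℕ} : {a : Ty} → Expr (Den n) a → Den n a
  | _, .var x => x
  | _, .letE e f => (f e.val).val
  | _, .ite b s t => bif b.val then s.val else t.val
  | _, .tt => true
  | _, .ff => false
  | _, .lit k => k
  | _, .add s t => s.val + t.val
  | _, .lt s t => decide (s.val < t.val)
  | _, .eq s t => decide (s.val = t.val)
  | _, .range k => List.range k.val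
  | _, .vertices => List.finRange n
  | _, .index v => (v.val : Fin n).val
  | _, .read M u v => M.val u.val v.val
  | _, .write M u v b => fun i j => if i = u.val ∧ j = v.val then b.val else M.val i j
  | _, .nil => []
  | _, .cons x l => x.val :: l.val
  | _, .pair x y => (x.val, y.val)
  | _, .fst p => p.val.1
  | _, .snd p => p.val.2
  | _, .foldl l init f => l.val.foldl (fun s x => (f s x).val) init.val
  | _, .q n m => qParam n.val m.val
  | _, .r n m => rParam n.val m.val
  | _, .dense n m => isDense n.val m.val

/-- The cost of a loop over a list that starts in state `s`, where one round in state `s` with list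
entry `x` leads to the state `step s x` and has cost `c s x`, plus one for moving on in the list. -/
def loopCost {α σ : Type} (step : σ → α → σ) (c : σ → α → ℕ) : σ → List α → ℕ
  | _, [] => 0
  | s, x :: l => 1 + c s x + loopCost step c (step s x) l

/-- The number of elementary steps of the evaluation of an expression: one step for every node of
the syntax tree each time that it is evaluated, and one more for each entry of a list that is
created by `range` or `vertices` or passed by a loop. -/
noncomputable def Expr.cost {n : ℕ} : {a : Ty} → Expr (Den n) a → ℕ
  | _, .var _ => 1
  | _, .letE e f => 1 + e.cost + (f e.val).cost
  | _, .ite b s t => 1 + b.cost + bif b.val then s.cost else t.cost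
  | _, .tt => 1
  | _, .ff => 1
  | _, .lit _ => 1
  | _, .add s t => 1 + s.cost + t.cost
  | _, .lt s t => 1 + s.cost + t.cost
  | _, .eq s t => 1 + s.cost + t.cost
  | _, .range k => 1 + k.cost + k.val
  | _, .vertices => 1 + n
  | _, .index v => 1 + v.cost
  | _, .read M u v => 1 + M.cost + u.cost + v.cost
  | _, .write M u v b => 1 + M.cost + u.cost + v.cost + b.cost
  | _, .nil => 1
  | _, .cons x l => 1 + x.cost + l.cost
  | _, .pair x y => 1 + x.cost + y.cost
  | _, .fst p => 1 + p.cost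
  | _, .snd p => 1 + p.cost
  | _, .foldl l init f =>
      1 + l.cost + init.cost +
        loopCost (fun s x => (f s x).val) (fun s x => (f s x).cost) init.val l.val
  | _, .q n m => 1 + n.cost + m.cost
  | _, .r n m => 1 + n.cost + m.cost
  | _, .dense n m => 1 + n.cost + m.cost

/-- A program with input of type `a` and output of type `b`: one syntax tree for all graphs. -/
def Program (a b : Ty) : Type 1 := ∀ rep : Ty → Type, rep a → Expr rep b

/-! ### Basic routines -/

section Routines

/-- Conjunction. -/
def andE {rep : Ty → Type} (s t : Expr rep .bool) : Expr rep .bool := .ite s t .ff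

/-- Disjunction. -/
def orE {rep : Ty → Type} (s t : Expr rep .bool) : Expr rep .bool := .ite s .tt t

/-- The number of entries of a list that satisfy `p`. -/
def countE {rep : Ty → Type} {a : Ty} (l : Expr rep (.list a)) (p : rep a → Expr rep .bool) :
    Expr rep .nat :=
  .foldl l (.lit 0) fun k x => .ite (p x) (.add (.var k) (.lit 1)) (.var k)

/-- The length of a list. -/
def lengthE {rep : Ty → Type} {a : Ty} (l : Expr rep (.list a)) : Expr rep .nat :=
  .foldl l (.lit 0) fun k _ => .add (.var k) (.lit 1)

/-- The reversed list. -/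
def reverseE {rep : Ty → Type} {a : Ty} (l : Expr rep (.list a)) : Expr rep (.list a) :=
  .foldl l .nil fun acc x => .cons (.var x) (.var acc)

/-- The list of the entries that satisfy `p`, in the original order. -/
def filterE {rep : Ty → Type} {a : Ty} (l : Expr rep (.list a)) (p : rep a → Expr rep .bool) :
    Expr rep (.list a) :=
  reverseE (.foldl l .nil fun acc x => .ite (p x) (.cons (.var x) (.var acc)) (.var acc))

/-- The first `k` entries of a list. -/
def takeE {rep : Ty → Type} {a : Ty} (k : rep .nat) (l : Expr rep (.list a)) :
    Expr rep (.list a) :=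
  reverseE (.foldl l .nil fun acc x =>
    .ite (.lt (lengthE (.var acc)) (.var k)) (.cons (.var x) (.var acc)) (.var acc))

/-- Do all entries of a list satisfy `p`? -/
def allE {rep : Ty → Type} {a : Ty} (l : Expr rep (.list a)) (p : rep a → Expr rep .bool) :
    Expr rep .bool :=
  .foldl l .tt fun b x => andE (.var b) (p x)

/-- Is the vertex `v` in the list `l`? -/
def memE {rep : Ty → Type} (v : rep .vertex) (l : Expr rep (.list .vertex)) : Expr rep .bool :=
  .foldl l .ff fun b x => orE (.var b) (.eq (.index (.var v)) (.index (.var x)))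

/-- Is `u < v` in the order of the vertices, and `uv` an edge? Each edge passes this test in
exactly one orientation. -/
def edgeE {rep : Ty → Type} (M : rep .matrix) (u v : rep .vertex) : Expr rep .bool :=
  andE (.lt (.index (.var u)) (.index (.var v))) (.read (.var M) (.var u) (.var v))

/-- The number of edges. -/
def numEdgesE {rep : Ty → Type} (M : rep .matrix) : Expr rep .nat :=
  .foldl .vertices (.lit 0) fun k u => .foldl .vertices (.var k) fun k v =>
    .ite (edgeE M u v) (.add (.var k) (.lit 1)) (.var k)

/-- The degree of `v`. -/
def degreeE {rep : Ty → Type} (M : rep .matrix) (v : rep .vertex) : Expr rep .nat :=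
  countE .vertices fun w => .read (.var M) (.var v) (.var w)

/-- The graph without the edges between `K.1` and `K.2`. -/
def deleteE {rep : Ty → Type} (M : Expr rep .matrix)
    (K : rep (.prod (.list .vertex) (.list .vertex))) : Expr rep .matrix :=
  .foldl (.fst (.var K)) M fun M a => .foldl (.snd (.var K)) (.var M) fun M b =>
    .write (.write (.var M) (.var a) (.var b) .ff) (.var b) (.var a) .ff

/-- The list `acc`, extended by a separate bipartite graph `({u}, {v})` for each edge `uv`. -/
def singleEdgesE {rep : Ty → Type} (M : rep .matrix)
    (acc : Expr rep (.list (.prod (.list .vertex) (.list .vertex)))) :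
    Expr rep (.list (.prod (.list .vertex) (.list .vertex))) :=
  .foldl .vertices acc fun acc u => .foldl .vertices (.var acc) fun acc v =>
    .ite (edgeE M u v)
      (.cons (.pair (.cons (.var u) .nil) (.cons (.var v) .nil)) (.var acc))
      (.var acc)

/-! ### FIND-BIPARTITE -/

/-- The number of vertices that precede `v` when the vertices are listed by decreasing degree, ties
being broken by the order of the vertices. -/
def rankE {rep : Ty → Type} (M : rep .matrix) (v : rep .vertex) : Expr rep .nat :=
  .letE (degreeE M v) fun dv => countE .vertices fun u => .letE (degreeE M u) fun du =>
    orE (.lt (.var dv) (.var du))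
      (andE (.eq (.var du) (.var dv)) (.lt (.index (.var u)) (.index (.var v))))

/-- `k` vertices having highest degree. -/
def topDegreeE {rep : Ty → Type} (M : rep .matrix) (k : rep .nat) : Expr rep (.list .vertex) :=
  filterE .vertices fun v => .lt (rankE M v) (.var k)

/-- All subsets of size `k` of a set `R` (given by a list without repetitions): going through `R`,
all subsets of size at most `k` are collected, and those of size `k` are kept. -/
def subsetsE {rep : Ty → Type} (k : rep .nat) (R : rep (.list .vertex)) :
    Expr rep (.list (.list .vertex)) :=
  filterE
    (.foldl (.var R) (.cons .nil .nil) fun acc x => .foldl (.var acc) (.var acc) fun acc' S =>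
      .ite (.lt (lengthE (.var S)) (.var k))
        (.cons (.cons (.var x) (.var S)) (.var acc')) (.var acc'))
    fun S => .eq (lengthE (.var S)) (.var k)

/-- The intersection of the sets `N(v) - R` over all `v` in `C`. -/
def commonE {rep : Ty → Type} (M : rep .matrix) (R C : rep (.list .vertex)) :
    Expr rep (.list .vertex) :=
  filterE .vertices fun w =>
    .ite (memE w (.var R)) .ff (allE (.var C) fun v => .read (.var M) (.var v) (.var w))

/-- FIND-BIPARTITE on a graph with `n` vertices and `m` edges. The result is the list with the
single entry `(C, D')` for the first `C` that succeeds, and the empty list if there is none. -/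
def findBipartite {rep : Ty → Type} (M : rep .matrix) (n m : rep .nat) :
    Expr rep (.list (.prod (.list .vertex) (.list .vertex))) :=
  .letE (.q (.var n) (.var m)) fun q =>
  .letE (.r (.var n) (.var m)) fun r =>
  .letE (topDegreeE M r) fun R =>
  .foldl (subsetsE q R) .nil fun res C =>
    .ite (.eq (lengthE (.var res)) (.lit 0))
      (.letE (commonE M R C) fun D =>
        .ite (.lt (lengthE (.var D)) (.var q)) .nil
          (.cons (.pair (.var C) (takeE q (.var D))) .nil))
      (.var res)

/-! ### The brute-force method for small graphs -/

/-- All sublists of a list. -/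
def sublistsE {rep : Ty → Type} {a : Ty} (l : Expr rep (.list a)) : Expr rep (.list (.list a)) :=
  .foldl l (.cons .nil .nil) fun acc x => .foldl (.var acc) (.var acc) fun acc' S =>
    .cons (.cons (.var x) (.var S)) (.var acc')

/-- All balanced complete bipartite subgraphs with non-empty parts. -/
def bicliquesE {rep : Ty → Type} (M : rep .matrix) :
    Expr rep (.list (.prod (.list .vertex) (.list .vertex))) :=
  .letE (sublistsE .vertices) fun P =>
  .foldl (.var P) .nil fun acc A => .foldl (.var P) (.var acc) fun acc B =>
    .ite
      (andE (.lt (.lit 0) (lengthE (.var A)))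
        (andE (.eq (lengthE (.var A)) (lengthE (.var B)))
          (allE (.var A) fun a => allE (.var B) fun b => .read (.var M) (.var a) (.var b))))
      (.cons (.pair (.var A) (.var B)) (.var acc)) (.var acc)

/-- Do the edge sets of the bipartite graphs in `L` partition the edge set of the graph? Their edges
are deleted one by one; each has to be present when it is deleted, and none may remain. -/
def checkE {rep : Ty → Type} (M : rep .matrix)
    (L : rep (.list (.prod (.list .vertex) (.list .vertex)))) : Expr rep .bool :=
  .letE
    (.foldl (.var L) (.pair (.var M) .tt) fun s K =>
      .foldl (.fst (.var K)) (.var s) fun s a => .foldl (.snd (.var K)) (.var s) fun s b =>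
        .ite (.read (.fst (.var s)) (.var a) (.var b))
          (.pair
            (.write (.write (.fst (.var s)) (.var a) (.var b) .ff) (.var b) (.var a) .ff)
            (.snd (.var s)))
          (.pair (.fst (.var s)) .ff))
    fun s => .letE (.fst (.var s)) fun M' =>
      andE (.snd (.var s)) (.eq (numEdgesE M') (.lit 0))

/-- The total number of vertices of the bipartite graphs in `L`. -/
def weightE {rep : Ty → Type} (L : rep (.list (.prod (.list .vertex) (.list .vertex)))) :
    Expr rep .nat :=
  .foldl (.var L) (.lit 0) fun k K =>
    .add (.var k) (.add (lengthE (.fst (.var K))) (lengthE (.snd (.var K))))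

/-- An optimal decomposition, by exhaustive search. -/
def bruteForce {rep : Ty → Type} (M : rep .matrix) :
    Expr rep (.list (.prod (.list .vertex) (.list .vertex))) :=
  .foldl (sublistsE (bicliquesE M)) (singleEdgesE M .nil) fun best L =>
    .ite (andE (checkE M L) (.lt (weightE L) (weightE best))) (.var L) (.var best)

/-! ### FIND-DECOMPOSITION -/

/-- FIND-DECOMPOSITION, with brute force on graphs with fewer than `n₀` vertices. The state of the
main loop consists of the current graph and the list of the subgraphs found so far. As each round
that finds a non-empty subgraph deletes an edge, the number of edges of the input graph bounds the
number of rounds. -/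
def findDecomposition (n₀ : ℕ) :
    Program .matrix (.list (.prod (.list .vertex) (.list .vertex))) := fun _ M =>
  .letE (lengthE .vertices) fun n =>
  .ite (.lt (.var n) (.lit n₀))
    (bruteForce M)
    (.letE
      (.foldl (.range (numEdgesE M)) (.pair (.var M) .nil) fun s _ =>
        .letE (.fst (.var s)) fun M =>
        .letE (numEdgesE M) fun m =>
        .ite (.dense (.var n) (.var m))
          (.foldl (findBipartite M n m) (.var s) fun s K =>
            .pair (deleteE (.fst (.var s)) K) (.cons (.var K) (.snd (.var s))))
          (.var s))
      fun s => .letE (.fst (.var s)) fun M => singleEdgesE M (.snd (.var s)))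

end Routines

/-! ### Running the algorithm on a graph -/

open Classical in
/-- The adjacency matrix that represents the input graph. -/
noncomputable def adjacency {n : ℕ} (G : SimpleGraph (Fin n)) : Den n .matrix :=
  fun u v => decide (G.Adj u v)

/-- The list of complete bipartite graphs that FIND-DECOMPOSITION returns for `G`. -/
noncomputable def output (n₀ : ℕ) {n : ℕ} (G : SimpleGraph (Fin n)) :
    List (Finset (Fin n) × Finset (Fin n)) :=
  (findDecomposition n₀ (Den n) (adjacency G)).val.map fun K => (K.1.toFinset, K.2.toFinset)

/-- The number of elementary steps of FIND-DECOMPOSITION on input `G`. -/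
noncomputable def runningTime (n₀ : ℕ) {n : ℕ} (G : SimpleGraph (Fin n)) : ℕ :=
  (findDecomposition n₀ (Den n) (adjacency G)).cost

end Biclique

/-!
Let `R` consist of the `r` vertices of highest degree, and count the pairs of a `q`-subset `C` of
`R` and a common neighbour of `C` outside `R`. A vertex `w` outside `R` with `d` neighbours in `R`
contributes `d.choose q ≥ d - (q - 1)`, and the numbers `d` add up to almost `2 * m * r / n`. As
`q * r.choose q` is small compared with `n`, some `C` has `q` common neighbours as soon as
`m > n² / log n`.

Each complete bipartite graph so found costs `2 * q` and removes `q²` edges, so an edge removed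
while `t` edges are left pays `2 / q`, which is of the order of
`log (2 * e * n² / t) / log (n / 2)`. Summing over the edges with the potential
`t * (log (A / t) + 1)`, an antiderivative of `t ↦ log (A / t)`, gives `O(n² / log n)`. The time is
polynomial because the number of subsets of `R` of size at most `q` is at most
`(e * n² / m) ^ q ≤ n / 2`.
-/

namespace Biclique

section Loops

variable {α β σ : Type*}

theorem foldl_cond_cons (p : α → Bool) (f : α → β) (l : List α) (acc : List β) :
    l.foldl (fun acc x => bif p x then f x :: acc else acc) acc =
      ((l.filter p).map f).reverse ++ acc := by
  simp only [cond_eq_ite]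
  exact List.foldl_filter.symm.trans (List.foldl_flip_cons_eq_append ..)

theorem foldl_cond_succ (p : α → Bool) (l : List α) (k : ℕ) :
    l.foldl (fun k x => bif p x then k + 1 else k) k = k + l.countP p := by
  simp only [cond_eq_ite]
  rw [← List.foldl_filter (f := fun k _ => k + 1), List.foldl_const, List.countP_eq_length_filter]
  exact Nat.succ_iterate ..

theorem foldl_cond_length_lt (k : ℕ) (l acc : List α) (h : acc.length ≤ k) :
    l.foldl (fun acc x => bif decide (acc.length < k) then x :: acc else acc) acc =
      (l.take (k - acc.length)).reverse ++ acc := by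
  induction l generalizing acc with
  | nil => simp
  | cons x l ih =>
    rcases h.eq_or_lt with rfl | hk
    · simp_all
    · obtain ⟨j, hj⟩ := Nat.exists_eq_add_of_lt hk
      have hrest : k - (x :: acc).length = j := by grind
      simp only [List.foldl_cons, hk, decide_true, cond_true]
      rw [ih (x :: acc) hk, hrest, show k - acc.length = j + 1 by omega]
      simp

theorem foldl_and (p : α → Bool) (l : List α) (b : Bool) :
    l.foldl (fun b x => b && p x) b = (b && l.all p) := by
  induction l generalizing b with
  | nil => simp
  | cons x l ih => rw [List.foldl_cons, ih, List.all_cons, Bool.and_assoc]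

theorem foldl_or (p : α → Bool) (l : List α) (b : Bool) :
    l.foldl (fun b x => b || p x) b = (b || l.any p) := by
  induction l generalizing b with
  | nil => simp
  | cons x l ih => rw [List.foldl_cons, ih, List.any_cons, Bool.or_assoc]

theorem foldl_foldl_eq_foldl_product (f : σ → α × β → σ) (l : List α) (l' : List β) (s : σ) :
    l.foldl (fun s x => l'.foldl (fun s y => f s (x, y)) s) s = (l ×ˢ l').foldl f s := by
  induction l generalizing s with
  | nil => rfl
  | cons x l ih =>
    rw [List.foldl_cons, ih, List.product_cons, List.foldl_append, List.foldl_map]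

theorem foldl_eq_toList_find? (p : α → Bool) (f : α → β) (l : List α) :
    l.foldl (fun res x =>
        bif decide (res.length = 0) then (bif p x then [] else [f x]) else res) [] =
      ((l.find? fun x => !p x).map f).toList := by
  have stay (l : List α) (y : β) : l.foldl (fun res x =>
      bif decide (res.length = 0) then (bif p x then [] else [f x]) else res) [y] = [y] := by
    induction l with
    | nil => rfl
    | cons x l ih => simpa using ih
  induction l with
  | nil => rfl
  | cons x l ih =>
    cases h : p x
    · simpa [h] using stay l (f x)
    · simpa [h] using ih

theorem foldl_cond_eq_or_mem (p : α → Bool) (c : α → α → Bool) (l : List α) (a : α) :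
    let best := l.foldl (fun best x => bif p x && c x best then x else best) a
    best = a ∨ best ∈ l ∧ p best := by
  refine List.foldlRecOn l _ (motive := fun y => y = a ∨ y ∈ l ∧ p y) (Or.inl rfl) ?_
  intro best ih x hx
  cases hc : p x && c x best
  · exact ih
  · exact Or.inr ⟨hx, (Bool.and_eq_true_iff.1 hc).1⟩

end Loops

section Sublists

variable {α : Type*}

/-- The lists that arise from `[[]]` by going through `R` and adding, for each entry `x` and each
list `S` found so far that satisfies `p`, the list `x :: S`. This is how the programs enumerate
subsets. -/
def collect (p : List α → Bool) (R : List α) : List (List α) :=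
  R.foldl (fun acc x => ((acc.filter p).map (x :: ·)).reverse ++ acc) [[]]

theorem collect_concat (p : List α → Bool) (R : List α) (x : α) :
    collect p (R ++ [x]) = (((collect p R).filter p).map (x :: ·)).reverse ++ collect p R := by
  simp [collect]

theorem reverse_sublist_of_mem_collect {p : List α → Bool} {R S : List α}
    (h : S ∈ collect p R) : S.reverse.Sublist R := by
  induction R using List.reverseRecOn generalizing S with
  | nil => simp_all [collect]
  | append_singleton R x ih =>
    simp only [collect_concat, List.mem_append, List.mem_reverse, List.mem_map,
      List.mem_filter] at h
    rcases h with ⟨T, ⟨hT, -⟩, rfl⟩ | hS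
    · simpa using ih hT
    · exact (ih hS).trans (List.sublist_append_left R [x])

theorem reverse_mem_collect {k : ℕ} {R S : List α} (hS : S.Sublist R) (hk : S.length ≤ k) :
    S.reverse ∈ collect (fun T => decide (T.length < k)) R := by
  induction R using List.reverseRecOn generalizing S with
  | nil => simp_all [collect]
  | append_singleton R x ih =>
    simp only [collect_concat, List.mem_append, List.mem_reverse, List.mem_map, List.mem_filter,
      decide_eq_true_eq]
    obtain ⟨S₁, S₂, rfl, hS₁, hS₂⟩ := List.sublist_append_iff.1 hS
    rcases List.sublist_singleton.1 hS₂ with rfl | rfl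
    · exact Or.inr (by simpa using ih hS₁ (by simpa using hk))
    · rw [List.length_append, List.length_singleton] at hk
      exact Or.inl ⟨S₁.reverse, ⟨ih hS₁ (by omega), by simpa using hk⟩, by simp⟩

theorem countP_length_le_collect {k j : ℕ} (hj : j ≤ k) (R : List α) :
    (collect (fun T => decide (T.length < k)) R).countP (fun S => decide (S.length ≤ j)) =
      ∑ i ∈ Finset.range (j + 1), R.length.choose i := by
  induction R using List.reverseRecOn generalizing j with
  | nil => simp [collect, Finset.sum_range_succ']
  | append_singleton R x ih =>
    rw [collect_concat, List.countP_append, List.countP_reverse, List.countP_map,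
      List.countP_filter, ih hj, List.length_append, List.length_singleton]
    rcases j with _ | j
    · simp
    · have hcons (S : List α) : (decide ((x :: S).length ≤ j + 1) && decide (S.length < k)) =
          decide (S.length ≤ j) := by
        rw [← Bool.decide_and, decide_eq_decide, List.length_cons]
        omega
      simp only [Function.comp_apply, hcons]
      rw [ih (by omega), Finset.sum_range_succ' _ (j + 1), Finset.sum_range_succ' _ (j + 1),
        ← add_assoc, ← Finset.sum_add_distrib]
      simp only [Nat.choose_succ_succ', Nat.choose_zero_right]

theorem length_collect_length_lt (k : ℕ) (R : List α) :
    (collect (fun T => decide (T.length < k)) R).length =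
      ∑ i ∈ Finset.range (k + 1), R.length.choose i := by
  rw [← countP_length_le_collect le_rfl, eq_comm, List.countP_eq_length]
  induction R using List.reverseRecOn with
  | nil => simp [collect]
  | append_singleton R x ih =>
    simp only [collect_concat, List.mem_append, List.mem_reverse, List.mem_map, List.mem_filter,
      decide_eq_true_eq] at ih ⊢
    rintro _ (⟨T, ⟨-, hT⟩, rfl⟩ | hS)
    · exact hT
    · exact ih _ hS

end Sublists

section Evaluation

variable {n : ℕ} {a : Ty}

/-- The values of type `Ty.matrix`: adjacency matrices. -/
abbrev BoolMatrix (n : ℕ) := Fin n → Fin n → Bool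

/-- A complete bipartite graph as it is represented in the programs, by lists of the vertices of
its two parts. -/
abbrev Parts (n : ℕ) := List (Fin n) × List (Fin n)

theorem val_andE (s t : Expr (Den n) .bool) : (andE s t).val = (s.val && t.val) :=
  Bool.cond_false_right ..

theorem val_orE (s t : Expr (Den n) .bool) : (orE s t).val = (s.val || t.val) :=
  Bool.cond_true_left ..

theorem val_countE (l : Expr (Den n) (.list a)) (p : Den n a → Expr (Den n) .bool) :
    (countE l p).val = l.val.countP fun x => (p x).val :=
  (foldl_cond_succ (fun x => (p x).val) l.val 0).trans (Nat.zero_add _)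

theorem val_lengthE (l : Expr (Den n) (.list a)) : (lengthE l).val = l.val.length := by
  simp only [lengthE, Expr.val, List.foldl_add_const, zero_add, one_mul]

theorem val_reverseE (l : Expr (Den n) (.list a)) : (reverseE l).val = l.val.reverse := by
  simp only [reverseE, Expr.val, List.foldl_flip_cons_eq_append', List.append_nil]

theorem val_filterE (l : Expr (Den n) (.list a)) (p : Den n a → Expr (Den n) .bool) :
    (filterE l p).val = l.val.filter fun x => (p x).val := by
  have hfold := foldl_cond_cons (fun x => (p x).val) id l.val []
  rw [List.map_id, List.append_nil] at hfold
  simp only [filterE, val_reverseE, Expr.val]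
  exact (congrArg List.reverse hfold).trans (List.reverse_reverse _)

theorem val_takeE (k : Den n .nat) (l : Expr (Den n) (.list a)) :
    (takeE k l).val = l.val.take k := by
  have hfold := foldl_cond_length_lt k l.val [] (Nat.zero_le k)
  simp only [takeE, val_reverseE, Expr.val, val_lengthE, hfold]
  simp

theorem val_allE (l : Expr (Den n) (.list a)) (p : Den n a → Expr (Den n) .bool) :
    (allE l p).val = l.val.all fun x => (p x).val := by
  simp only [allE, val_andE, Expr.val]
  exact foldl_and (fun x => (p x).val) l.val true

theorem val_memE (v : Fin n) (l : Expr (Den n) (.list .vertex)) :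
    (memE v l).val = decide (v ∈ (l.val : List (Fin n))) := by
  simp only [memE, val_orE, Expr.val]
  refine (foldl_or (fun x : Fin n => decide (v.val = x.val)) _ _).trans ?_
  rw [Bool.eq_iff_iff]
  simp [Fin.val_inj]

/-- The pairs `(u, v)` with `u < v` and a non-zero entry of `M` in row `u` and column `v`, in the
order in which two nested loops find them. -/
def edgePairs (M : BoolMatrix n) : List (Fin n × Fin n) :=
  (List.finRange n ×ˢ List.finRange n).filter fun e => decide (e.1 < e.2) && M e.1 e.2

theorem val_edgeE (M : BoolMatrix n) (u v : Fin n) :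
    (edgeE (rep := Den n) M u v).val = (decide (u < v) && M u v) := by
  simp only [edgeE, val_andE, Expr.val]
  rfl

theorem val_numEdgesE (M : Den n .matrix) : (numEdgesE M).val = (edgePairs M).length := by
  simp only [numEdgesE, Expr.val, val_edgeE]
  rw [foldl_foldl_eq_foldl_product fun (k : ℕ) (e : Fin n × Fin n) =>
    bif decide (e.1 < e.2) && M e.1 e.2 then k + 1 else k]
  exact (foldl_cond_succ ..).trans (by rw [Nat.zero_add, List.countP_eq_length_filter]; rfl)

theorem val_singleEdgesE (M : Den n .matrix)
    (acc : Expr (Den n) (.list (.prod (.list .vertex) (.list .vertex)))) :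
    (singleEdgesE M acc).val =
      ((edgePairs M).map fun e => ([e.1], [e.2])).reverse ++ acc.val := by
  simp only [singleEdgesE, Expr.val, val_edgeE]
  rw [foldl_foldl_eq_foldl_product fun (acc : List (Parts n)) (e : Fin n × Fin n) =>
    bif decide (e.1 < e.2) && M e.1 e.2 then ([e.1], [e.2]) :: acc else acc]
  exact foldl_cond_cons (fun e : Fin n × Fin n => decide (e.1 < e.2) && M e.1 e.2)
    (fun e => ([e.1], [e.2])) ..

theorem val_degreeE (M : Den n .matrix) (v : Den n .vertex) :
    (degreeE M v).val = (List.finRange n).countP (M v) :=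
  val_countE ..

theorem val_rankE (M : BoolMatrix n) (v : Fin n) :
    (rankE (rep := Den n) M v).val = (List.finRange n).countP fun u =>
      decide ((degreeE (rep := Den n) M v).val < (degreeE (rep := Den n) M u).val) ||
        (decide ((degreeE (rep := Den n) M u).val = (degreeE (rep := Den n) M v).val) &&
          decide (u < v)) := by
  simp only [rankE, val_countE, val_andE, val_orE, Expr.val]
  rfl

theorem val_topDegreeE (M : Den n .matrix) (k : Den n .nat) :
    (topDegreeE M k).val =
      (List.finRange n).filter fun v => decide ((rankE (rep := Den n) M v).val < k) := by
  simp only [topDegreeE, val_filterE, Expr.val]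
  rfl

/-- The body of the loop of `subsetsE`: the lists in `acc`, together with the list `x :: S` for each
`S` in `acc` of length less than `k`. -/
def extendE {rep : Ty → Type} (k : rep .nat) (acc : rep (.list (.list .vertex)))
    (x : rep .vertex) : Expr rep (.list (.list .vertex)) :=
  .foldl (.var acc) (.var acc) fun acc' S => .ite (.lt (lengthE (.var S)) (.var k))
    (.cons (.cons (.var x) (.var S)) (.var acc')) (.var acc')

theorem foldl_val_extendE (k : ℕ) (R : List (Fin n)) :
    R.foldl (fun (acc : List (List (Fin n))) x => (extendE (rep := Den n) k acc x).val) [[]] =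
      collect (fun S => decide (S.length < k)) R := by
  rw [collect]
  congr 1
  funext acc x
  simp only [extendE, Expr.val, val_lengthE]
  exact foldl_cond_cons (fun S : List (Fin n) => decide (S.length < k)) (x :: ·) acc acc

theorem val_subsetsE (k : ℕ) (R : List (Fin n)) :
    (subsetsE (rep := Den n) k R).val =
      (collect (fun S => decide (S.length < k)) R).filter fun S => decide (S.length = k) := by
  rw [subsetsE, val_filterE, ← foldl_val_extendE]
  simp only [extendE, Expr.val, val_lengthE]

theorem val_commonE (M : BoolMatrix n) (R C : List (Fin n)) :
    (commonE (rep := Den n) M R C).val = (List.finRange n).filter fun w =>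
      !decide (w ∈ R) && C.all fun v => M v w := by
  simp only [commonE, val_filterE, val_allE, Expr.val, val_memE, Bool.cond_false_left]
  rfl

theorem val_findBipartite (M : BoolMatrix n) (m : ℕ) :
    let q := qParam n m
    let R := (topDegreeE (rep := Den n) M (rParam n m)).val
    (findBipartite (rep := Den n) M n m).val =
      (((subsetsE (rep := Den n) q R).val.find? fun C : List (Fin n) =>
          !decide ((commonE (rep := Den n) M R C).val.length < q)).map fun C : List (Fin n) =>
        (C, (commonE (rep := Den n) M R C).val.take q)).toList := by
  simp only [findBipartite, Expr.val, val_lengthE, val_takeE]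
  exact foldl_eq_toList_find? ..

/-- The matrix after deleting the edge `e` in both orientations. -/
def deletePair (M : BoolMatrix n) (e : Fin n × Fin n) : BoolMatrix n :=
  fun i j => if i = e.2 ∧ j = e.1 then false else if i = e.1 ∧ j = e.2 then false else M i j

theorem val_deleteE (M : Expr (Den n) .matrix) (K : Parts n) :
    (deleteE (rep := Den n) M K).val = (K.1 ×ˢ K.2).foldl deletePair M.val := by
  simp only [deleteE, Expr.val]
  rw [← foldl_foldl_eq_foldl_product]
  rfl

theorem val_sublistsE (l : Expr (Den n) (.list a)) :
    (sublistsE l).val = collect (fun _ => true) l.val := by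
  simp only [sublistsE, Expr.val, collect, List.foldl_flip_cons_eq_append, List.filter_true]

theorem val_bicliquesE (M : BoolMatrix n) :
    let P := collect (fun _ => true) (List.finRange n)
    (bicliquesE (rep := Den n) M).val = ((P ×ˢ P).filter fun K : Parts n =>
      decide (0 < K.1.length) &&
        (decide (K.1.length = K.2.length) && K.1.all fun a => K.2.all fun b => M a b)).reverse := by
  simp only [bicliquesE, Expr.val, val_andE, val_lengthE, val_allE, val_sublistsE]
  rw [foldl_foldl_eq_foldl_product fun (acc : List (Parts n)) (K : Parts n) =>
    bif decide (0 < K.1.length) && (decide (K.1.length = K.2.length) &&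
      K.1.all fun a => K.2.all fun b => M a b) then K :: acc else acc]
  exact (foldl_cond_cons _ id ..).trans (by rw [List.map_id, List.append_nil])

/-- One step of the test whether edges can be deleted one after the other. -/
def checkPair (s : BoolMatrix n × Bool) (e : Fin n × Fin n) : BoolMatrix n × Bool :=
  bif s.1 e.1 e.2 then (deletePair s.1 e, s.2) else (s.1, false)

theorem val_checkE (M : BoolMatrix n) (L : List (Parts n)) :
    let s := (L.flatMap fun K => K.1 ×ˢ K.2).foldl checkPair (M, true)
    (checkE (rep := Den n) M L).val =
      (s.2 && decide ((numEdgesE (rep := Den n) s.1).val = 0)) := by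
  simp only [List.foldl_flatMap, ← foldl_foldl_eq_foldl_product, checkE, Expr.val, val_andE]
  rfl

theorem val_bruteForce (M : BoolMatrix n) :
    let L := (bruteForce (rep := Den n) M).val
    L = (singleEdgesE (rep := Den n) M .nil).val ∨
      L ∈ collect (fun _ => true) (bicliquesE (rep := Den n) M).val ∧
        (checkE (rep := Den n) M L).val = true := by
  simp only [bruteForce, Expr.val, val_andE, val_sublistsE]
  exact foldl_cond_eq_or_mem (fun L => (checkE (rep := Den n) M L).val) ..

end Evaluation

section Decompositions

variable {V : Type*} {G H : SimpleGraph V} {K : Finset V × Finset V}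

/-- `K` is a balanced complete bipartite subgraph of `G`; that its parts are disjoint follows from
the irreflexivity of `G.Adj`. -/
structure IsBalancedBiclique (G : SimpleGraph V) (K : Finset V × Finset V) : Prop where
  nonempty : K.1.Nonempty
  balanced : K.1.card = K.2.card
  adj : ∀ a ∈ K.1, ∀ b ∈ K.2, G.Adj a b

theorem IsBalancedBiclique.disjoint (h : IsBalancedBiclique G K) : Disjoint K.1 K.2 :=
  Finset.disjoint_left.2 fun a ha hb => (h.adj a ha a hb).ne rfl

theorem IsBalancedBiclique.edges_subset (h : IsBalancedBiclique G K) : edges K ⊆ G.edgeSet := by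
  rintro _ ⟨a, ha, b, hb, rfl⟩
  exact h.adj a ha b hb

theorem IsBalancedBiclique.edgeSet_fromEdgeSet_edges (h : IsBalancedBiclique G K) :
    (SimpleGraph.fromEdgeSet (edges K)).edgeSet = edges K := by
  rw [SimpleGraph.edgeSet_fromEdgeSet, sdiff_eq_left, Set.disjoint_left]
  exact fun e he => G.not_isDiag_of_mem_edgeSet (h.edges_subset he)

theorem IsBalancedBiclique.fromEdgeSet_edges_le (h : IsBalancedBiclique G K) :
    SimpleGraph.fromEdgeSet (edges K) ≤ G := by
  rw [← SimpleGraph.edgeSet_subset_edgeSet, h.edgeSet_fromEdgeSet_edges]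
  exact h.edges_subset

theorem IsBalancedBiclique.ncard_edges (h : IsBalancedBiclique G K) :
    (edges K).ncard = K.1.card ^ 2 := by
  have himage : edges K = (fun p : V × V => s(p.1, p.2)) '' (K.1 ×ˢ K.2 : Finset (V × V)) := by
    ext e
    simp only [edges, Set.mem_ofPred_eq, Finset.coe_product, Set.mem_image, Set.mem_prod,
      Prod.exists]
    grind
  have hinj : Set.InjOn (fun p : V × V => s(p.1, p.2)) (K.1 ×ˢ K.2 : Finset (V × V)) := by
    rintro ⟨a, b⟩ hab ⟨a', b'⟩ hab' heq
    simp only [Finset.coe_product, Set.mem_prod, Finset.mem_coe] at hab hab'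
    rcases Sym2.eq_iff.1 heq with ⟨rfl, rfl⟩ | ⟨rfl, rfl⟩
    · rfl
    · exact (Finset.disjoint_left.1 h.disjoint hab.1 hab'.2).elim
  rw [himage, hinj.ncard_image, Set.ncard_coe_finset, Finset.card_product,
    ← h.balanced, sq]

theorem IsBalancedBiclique.isBalancedDecomposition (h : IsBalancedBiclique G K) :
    IsBalancedDecomposition (SimpleGraph.fromEdgeSet (edges K)) [K] where
  nonempty := by simpa using h.nonempty
  disjoint_parts := by simpa using h.disjoint
  balanced := by simpa using h.balanced
  edge_disjoint := List.pairwise_singleton ..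
  cover e := by simp [h.edgeSet_fromEdgeSet_edges]

theorem isBalancedDecomposition_nil : IsBalancedDecomposition (⊥ : SimpleGraph V) [] := by
  constructor <;> simp

theorem IsBalancedDecomposition.append {G₁ G₂ : SimpleGraph V} {L₁ L₂ : List (Finset V × Finset V)}
    (h₁ : IsBalancedDecomposition G₁ L₁) (h₂ : IsBalancedDecomposition G₂ L₂)
    (h : Disjoint G₁ G₂) : IsBalancedDecomposition (G₁ ⊔ G₂) (L₁ ++ L₂) where
  nonempty := List.forall_mem_append.2 ⟨h₁.nonempty, h₂.nonempty⟩
  disjoint_parts := List.forall_mem_append.2 ⟨h₁.disjoint_parts, h₂.disjoint_parts⟩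
  balanced := List.forall_mem_append.2 ⟨h₁.balanced, h₂.balanced⟩
  edge_disjoint := by
    refine List.pairwise_append.2 ⟨h₁.edge_disjoint, h₂.edge_disjoint, fun K₁ hK₁ K₂ hK₂ => ?_⟩
    refine (SimpleGraph.disjoint_edgeSet.2 h).mono (fun e he => ?_) fun e he => ?_
    · exact (h₁.cover e).2 ⟨K₁, hK₁, he⟩
    · exact (h₂.cover e).2 ⟨K₂, hK₂, he⟩
  cover e := by
    simp only [SimpleGraph.edgeSet_sup, Set.mem_union, h₁.cover, h₂.cover, List.mem_append,
      or_and_right, exists_or]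

theorem IsBalancedDecomposition.cons {L : List (Finset V × Finset V)}
    (h : IsBalancedDecomposition (G.deleteEdges (edges K)) L) (hK : IsBalancedBiclique G K) :
    IsBalancedDecomposition G (K :: L) := by
  rw [← sup_sdiff_cancel_right hK.fromEdgeSet_edges_le]
  exact hK.isBalancedDecomposition.append h disjoint_sdiff_self_right

theorem IsBalancedDecomposition.cons_of_sdiff {L : List (Finset V × Finset V)}
    (h : IsBalancedDecomposition (G \ H) L) (hHG : H ≤ G) (hK : IsBalancedBiclique H K) :
    IsBalancedDecomposition (G \ H.deleteEdges (edges K)) (K :: L) := by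
  refine .cons ?_ ⟨hK.nonempty, hK.balanced, fun a ha b hb => ?_⟩
  · rwa [SimpleGraph.deleteEdges, SimpleGraph.deleteEdges, sdiff_sdiff_left,
      sdiff_sup_cancel hK.fromEdgeSet_edges_le]
  · have hmem : s(a, b) ∈ edges K := ⟨a, ha, b, hb, rfl⟩
    simp only [SimpleGraph.sdiff_adj, SimpleGraph.deleteEdges_adj, hmem, not_true_eq_false,
      and_false, not_false_eq_true, and_true]
    exact hHG (hK.adj a ha b hb)

theorem complexity_append (L L' : List (Finset V × Finset V)) :
    complexity (L ++ L') = complexity L + complexity L' := by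
  simp only [complexity, List.map_append, List.sum_append]

theorem IsBalancedBiclique.complexity_cons (h : IsBalancedBiclique G K)
    (L : List (Finset V × Finset V)) : complexity (K :: L) = 2 * K.1.card + complexity L := by
  simp only [complexity, List.map_cons, List.sum_cons, ← h.balanced]
  omega

theorem ncard_edgeSet_deleteEdges_add [Finite V] {E : Set (Sym2 V)} (h : E ⊆ G.edgeSet) :
    (G.deleteEdges E).edgeSet.ncard + E.ncard = G.edgeSet.ncard := by
  rw [SimpleGraph.edgeSet_deleteEdges, Set.ncard_sdiff_add_ncard_of_subset h]

end Decompositions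

section Matrices

variable {n : ℕ} {G H : SimpleGraph (Fin n)}

/-- The pair of vertex sets that a pair of lists stands for. -/
def toFinsets (K : Parts n) : Finset (Fin n) × Finset (Fin n) := (K.1.toFinset, K.2.toFinset)

/-- The edge set given by the list `P` of pairs of vertices. -/
def edgesOf (P : List (Fin n × Fin n)) : Set (Sym2 (Fin n)) := {e | ∃ p ∈ P, e = s(p.1, p.2)}

theorem edgesOf_cons (p : Fin n × Fin n) (P : List (Fin n × Fin n)) :
    edgesOf (p :: P) = {s(p.1, p.2)} ∪ edgesOf P := by
  ext e
  simp [edgesOf]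

theorem edgesOf_product (K : Parts n) : edgesOf (K.1 ×ˢ K.2) = edges (toFinsets K) := by
  ext e
  simp only [edgesOf, edges, toFinsets, Set.mem_ofPred_eq, List.mem_toFinset]
  constructor
  · rintro ⟨⟨a, b⟩, hab, rfl⟩
    obtain ⟨ha, hb⟩ := List.pair_mem_product.1 hab
    exact ⟨a, ha, b, hb, rfl⟩
  · rintro ⟨a, ha, b, hb, rfl⟩
    exact ⟨(a, b), List.pair_mem_product.2 ⟨ha, hb⟩, rfl⟩

theorem mem_edgePairs_adjacency {e : Fin n × Fin n} :
    e ∈ edgePairs (adjacency H) ↔ e.1 < e.2 ∧ H.Adj e.1 e.2 := by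
  simp only [edgePairs, adjacency, List.mem_filter, Bool.and_eq_true, decide_eq_true_eq,
    and_iff_right_iff_imp]
  exact fun _ => List.pair_mem_product.2 ⟨List.mem_finRange _, List.mem_finRange _⟩

theorem exists_mem_edgePairs_adjacency {e : Sym2 (Fin n)} :
    (∃ p ∈ edgePairs (adjacency H), s(p.1, p.2) = e) ↔ e ∈ H.edgeSet := by
  simp only [mem_edgePairs_adjacency]
  constructor
  · rintro ⟨p, hp, rfl⟩
    exact hp.2
  · induction e using Sym2.ind with
    | _ u v =>
      intro huv
      rcases lt_or_gt_of_ne (H.ne_of_adj huv) with hlt | hlt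
      · exact ⟨(u, v), ⟨hlt, huv⟩, rfl⟩
      · exact ⟨(v, u), ⟨hlt, huv.symm⟩, Sym2.eq_swap⟩

theorem nodup_map_edgePairs (M : BoolMatrix n) :
    ((edgePairs M).map fun e => s(e.1, e.2)).Nodup := by
  refine List.Nodup.map_on ?_
    (((List.nodup_finRange n).product (List.nodup_finRange n)).filter _)
  rintro ⟨u, v⟩ huv ⟨u', v'⟩ huv' heq
  simp only [edgePairs, List.mem_filter, Bool.and_eq_true, decide_eq_true_eq] at huv huv'
  rcases Sym2.eq_iff.1 heq with ⟨rfl, rfl⟩ | ⟨rfl, rfl⟩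
  · rfl
  · exact (lt_asymm huv.2.1 huv'.2.1).elim

theorem val_numEdgesE_adjacency (H : SimpleGraph (Fin n)) :
    (numEdgesE (adjacency H)).val = H.edgeSet.ncard := by
  have hset : H.edgeSet = ((edgePairs (adjacency H)).map fun e => s(e.1, e.2)).toFinset := by
    ext e
    simp only [List.coe_toFinset, List.mem_map, Set.mem_ofPred_eq, exists_mem_edgePairs_adjacency]
  rw [hset, Set.ncard_coe_finset, List.toFinset_card_of_nodup (nodup_map_edgePairs _),
    List.length_map, val_numEdgesE]

theorem two_mul_ncard_edgeSet_le (H : SimpleGraph (Fin n)) : 2 * H.edgeSet.ncard ≤ n ^ 2 := by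
  classical
  rw [← SimpleGraph.coe_edgeFinset, Set.ncard_coe_finset, ← H.sum_degrees_eq_twice_card_edges]
  calc ∑ v, H.degree v ≤ ∑ _v : Fin n, n :=
        Finset.sum_le_sum fun v _ => by simpa using (H.degree_lt_card_verts v).le
    _ = n ^ 2 := by simp [sq]

theorem deletePair_adjacency (H : SimpleGraph (Fin n)) (e : Fin n × Fin n) :
    deletePair (adjacency H) e = adjacency (H.deleteEdges {s(e.1, e.2)}) := by
  funext i j
  rw [Bool.eq_iff_iff]
  simp only [deletePair, adjacency, decide_eq_true_eq, SimpleGraph.deleteEdges_adj,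
    Set.mem_singleton_iff, Sym2.eq_iff]
  split_ifs <;> simp_all

theorem foldl_deletePair (P : List (Fin n × Fin n)) (H : SimpleGraph (Fin n)) :
    P.foldl deletePair (adjacency H) = adjacency (H.deleteEdges (edgesOf P)) := by
  induction P generalizing H with
  | nil => simp [edgesOf]
  | cons p P ih =>
    rw [List.foldl_cons, deletePair_adjacency, ih, SimpleGraph.deleteEdges_deleteEdges,
      edgesOf_cons]

theorem val_deleteE_adjacency {M : Expr (Den n) .matrix} (hM : M.val = adjacency H)
    (K : Parts n) :
    (deleteE (rep := Den n) M K).val = adjacency (H.deleteEdges (edges (toFinsets K))) := by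
  rw [val_deleteE, hM, foldl_deletePair, edgesOf_product]

theorem isBalancedDecomposition_edgePairs (H : SimpleGraph (Fin n)) :
    IsBalancedDecomposition H
      (((edgePairs (adjacency H)).map fun e => ([e.1], [e.2])).reverse.map toFinsets) := by
  have hedges (u v : Fin n) : edges (toFinsets ([u], [v])) = {s(u, v)} := by
    ext e
    simp [edges, toFinsets]
  rw [List.map_reverse, List.map_map]
  constructor
  · simp only [List.mem_reverse, List.forall_mem_map]
    exact fun e _ => by simp [toFinsets]
  · simp only [List.mem_reverse, List.forall_mem_map, mem_edgePairs_adjacency]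
    exact fun e he => by simpa [toFinsets] using he.1.ne
  · simp only [List.mem_reverse, List.forall_mem_map]
    exact fun e _ => by simp [toFinsets]
  · simp only [List.pairwise_reverse, List.pairwise_map, Function.comp_apply, hedges]
    refine (List.pairwise_map.1 (nodup_map_edgePairs _)).imp fun hne => ?_
    exact Set.disjoint_singleton.2 hne.symm
  · intro e
    simp only [List.mem_reverse, List.mem_map, exists_exists_and_eq_and, Function.comp_apply,
      hedges, Set.mem_singleton_iff, eq_comm (a := e), exists_mem_edgePairs_adjacency]

theorem isBalancedDecomposition_singleEdgesE (hHG : H ≤ G) {L : List (Parts n)}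
    (h : IsBalancedDecomposition (G \ H) (L.map toFinsets))
    {acc : Expr (Den n) (.list (.prod (.list .vertex) (.list .vertex)))} (hacc : acc.val = L) :
    IsBalancedDecomposition G ((singleEdgesE (adjacency H) acc).val.map toFinsets) := by
  rw [val_singleEdgesE, hacc, List.map_append, ← sup_sdiff_cancel_right hHG]
  exact (isBalancedDecomposition_edgePairs H).append h disjoint_sdiff_self_right

theorem complexity_singleEdgesE (H : SimpleGraph (Fin n)) {L : List (Parts n)}
    {acc : Expr (Den n) (.list (.prod (.list .vertex) (.list .vertex)))} (hacc : acc.val = L) :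
    complexity ((singleEdgesE (adjacency H) acc).val.map toFinsets) =
      2 * H.edgeSet.ncard + complexity (L.map toFinsets) := by
  rw [val_singleEdgesE, hacc, List.map_append, complexity_append, ← val_numEdgesE_adjacency,
    val_numEdgesE]
  simp [complexity, toFinsets, Function.comp_def, mul_comm]

end Matrices

section BruteForce

variable {n : ℕ} {G H : SimpleGraph (Fin n)}

theorem snd_of_snd_foldl_checkPair {P : List (Fin n × Fin n)} {s : BoolMatrix n × Bool}
    (h : (P.foldl checkPair s).2 = true) : s.2 = true := by
  induction P generalizing s with
  | nil => exact h
  | cons p P ih =>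
    have hstep : (checkPair s p).2 = true := ih h
    cases hp : s.1 p.1 p.2 <;> simp_all [checkPair]

theorem foldl_checkPair {P : List (Fin n × Fin n)}
    (h : (P.foldl checkPair (adjacency H, true)).2 = true) :
    edgesOf P ⊆ H.edgeSet ∧
      P.foldl checkPair (adjacency H, true) = (adjacency (H.deleteEdges (edgesOf P)), true) := by
  induction P generalizing H with
  | nil => simp [edgesOf]
  | cons p P ih =>
    rw [List.foldl_cons] at h ⊢
    have hp : H.Adj p.1 p.2 := by
      by_contra hp
      simpa [checkPair, adjacency, hp] using snd_of_snd_foldl_checkPair h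
    have hstep : checkPair (adjacency H, true) p =
        (adjacency (H.deleteEdges {s(p.1, p.2)}), true) := by
      rw [checkPair, deletePair_adjacency]
      simp [adjacency, hp]
    rw [hstep] at h ⊢
    obtain ⟨hsub, hval⟩ := ih h
    rw [hval, SimpleGraph.deleteEdges_deleteEdges, edgesOf_cons]
    refine ⟨Set.union_subset (Set.singleton_subset_iff.2 hp) ?_, rfl⟩
    exact hsub.trans (SimpleGraph.edgeSet_mono (SimpleGraph.deleteEdges_le _))

theorem isBalancedDecomposition_of_foldl_checkPair {L : List (Parts n)}
    (hL : ∀ K ∈ L, IsBalancedBiclique G (toFinsets K))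
    (h : ((L.flatMap fun K => K.1 ×ˢ K.2).foldl checkPair (adjacency H, true)).2 = true) :
    ∃ H' ≤ H,
      ((L.flatMap fun K => K.1 ×ˢ K.2).foldl checkPair (adjacency H, true)).1 = adjacency H' ∧
        IsBalancedDecomposition (H \ H') (L.map toFinsets) := by
  induction L generalizing H with
  | nil => exact ⟨H, le_rfl, rfl, by simpa using isBalancedDecomposition_nil⟩
  | cons K L ih =>
    obtain ⟨hK, hL⟩ := List.forall_mem_cons.1 hL
    rw [List.flatMap_cons, List.foldl_append] at h ⊢
    obtain ⟨hsub, hval⟩ := foldl_checkPair (snd_of_snd_foldl_checkPair h)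
    rw [hval, edgesOf_product] at h ⊢
    rw [edgesOf_product] at hsub
    obtain ⟨H', hH', hval', hdec⟩ := ih hL h
    have hKH' : IsBalancedBiclique (H \ H') (toFinsets K) := by
      refine ⟨hK.nonempty, hK.balanced, fun a ha b hb => ?_⟩
      have hab : s(a, b) ∈ edges (toFinsets K) := ⟨a, ha, b, hb, rfl⟩
      exact ⟨hsub hab, fun hadj => ((SimpleGraph.deleteEdges_adj ..).1 (hH' hadj)).2 hab⟩
    refine ⟨H', hH'.trans (SimpleGraph.deleteEdges_le _), hval', .cons ?_ hKH'⟩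
    rwa [SimpleGraph.deleteEdges, sdiff_right_comm]

theorem nodup_of_mem_collect_finRange {p : List (Fin n) → Bool} {S : List (Fin n)}
    (h : S ∈ collect p (List.finRange n)) : S.Nodup :=
  List.nodup_reverse.1 ((reverse_sublist_of_mem_collect h).nodup (List.nodup_finRange n))

theorem isBalancedBiclique_of_mem_bicliquesE {K : Parts n}
    (hK : K ∈ (bicliquesE (adjacency G)).val) : IsBalancedBiclique G (toFinsets K) := by
  rw [val_bicliquesE, List.mem_reverse, List.mem_filter] at hK
  simp only [Bool.and_eq_true, List.all_eq_true, decide_eq_true_eq] at hK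
  obtain ⟨hmem, hpos, hcard, hadj⟩ := hK
  obtain ⟨hA, hB⟩ := List.pair_mem_product.1 hmem
  constructor
  · rw [← Finset.card_pos]
    exact (List.toFinset_card_of_nodup (nodup_of_mem_collect_finRange hA)).symm ▸ hpos
  · exact (List.toFinset_card_of_nodup (nodup_of_mem_collect_finRange hA)).trans
      (hcard.trans (List.toFinset_card_of_nodup (nodup_of_mem_collect_finRange hB)).symm)
  · simpa [toFinsets, adjacency] using hadj

theorem eq_bot_of_numEdgesE_eq_zero (h : (numEdgesE (adjacency H)).val = 0) : H = ⊥ := by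
  rwa [val_numEdgesE_adjacency, Set.ncard_eq_zero, SimpleGraph.edgeSet_eq_empty] at h

theorem isBalancedDecomposition_bruteForce (G : SimpleGraph (Fin n)) :
    IsBalancedDecomposition G ((bruteForce (adjacency G)).val.map toFinsets) := by
  rcases val_bruteForce (adjacency G) with hsingle | ⟨hmem, hcheck⟩
  · rw [hsingle]
    exact isBalancedDecomposition_singleEdgesE le_rfl
      (sdiff_self (a := G) ▸ isBalancedDecomposition_nil) rfl
  · rw [val_checkE, Bool.and_eq_true, decide_eq_true_eq] at hcheck
    obtain ⟨H, -, hval, hdec⟩ := isBalancedDecomposition_of_foldl_checkPair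
      (fun K hK => isBalancedBiclique_of_mem_bicliquesE
        ((reverse_sublist_of_mem_collect hmem).subset (List.mem_reverse.2 hK))) hcheck.1
    rw [hval] at hcheck
    rwa [eq_bot_of_numEdgesE_eq_zero hcheck.2, sdiff_bot] at hdec

end BruteForce

section Rank

open Finset

variable {ι α : Type*} [Fintype ι] [LinearOrder α]

/-- The position of `v`, counted from `0`, when the elements of `ι` are listed by increasing value
of `f`. -/
def rank (f : ι → α) (v : ι) : ℕ := #{u | f u < f v}

theorem rank_lt_rank_iff {f : ι → α} {u v : ι} : rank f u < rank f v ↔ f u < f v := by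
  refine ⟨fun h => lt_of_not_ge fun hle => h.not_ge (card_le_card ?_), fun h => card_lt_card ?_⟩
  · exact monotone_filter_right _ fun w _ hw => hw.trans_le hle
  · refine ssubset_iff_of_subset (monotone_filter_right _ fun w _ hw => hw.trans h) |>.2 ⟨u, ?_⟩
    simpa using h

theorem rank_lt_card (f : ι → α) (v : ι) : rank f v < Fintype.card ι :=
  card_lt_univ_of_notMem (x := v) (by simp)

theorem rank_injective {f : ι → α} (hf : f.Injective) : (rank f).Injective := fun _ _ h =>
  hf <| le_antisymm (not_lt.1 fun hlt => (rank_lt_rank_iff.2 hlt).ne' h)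
    (not_lt.1 fun hlt => (rank_lt_rank_iff.2 hlt).ne h)

theorem card_rank_lt {f : ι → α} (hf : f.Injective) {r : ℕ} (hr : r ≤ Fintype.card ι) :
    #{v | rank f v < r} = r := by
  have himage : univ.image (rank f) = range (Fintype.card ι) := by
    refine eq_of_subset_of_card_le (image_subset_iff.2 fun v _ => mem_range.2 (rank_lt_card f v)) ?_
    rw [card_image_of_injective _ (rank_injective hf), card_range, card_univ]
  calc #{v | rank f v < r} = #((univ.filter fun v => rank f v < r).image (rank f)) :=
        (card_image_of_injective _ (rank_injective hf)).symm
    _ = #((range (Fintype.card ι)).filter (· < r)) := by rw [← himage, filter_image]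
    _ = r := by rw [show (range (Fintype.card ι)).filter (· < r) = range r by ext; simp; omega,
      card_range]

end Rank

section TopDegree

open OrderDual

variable {n : ℕ} (H : SimpleGraph (Fin n)) [DecidableRel H.Adj]

/-- The vertices in the order of `rankE`: increasing keys mean decreasing degrees, ties being broken
by the order of the vertices. -/
def degreeKey (v : Fin n) : ℕᵒᵈ ×ₗ Fin n := toLex (toDual (H.degree v), v)

theorem degreeKey_injective : (degreeKey H).Injective := fun _ _ h =>
  congrArg (fun k => (ofLex k).2) h

theorem degree_le_of_degreeKey_le {u v : Fin n} (h : degreeKey H u ≤ degreeKey H v) :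
    H.degree v ≤ H.degree u :=
  Prod.Lex.monotone_fst _ _ h

theorem countP_finRange (p : Fin n → Bool) :
    (List.finRange n).countP p = (Finset.univ.filter fun v => p v).card := by
  rw [List.countP_eq_length_filter, Finset.card_def, Finset.filter_val, Fin.univ_def,
    Multiset.filter_coe, Multiset.coe_card]
  simp

theorem val_degreeE_adjacency (v : Fin n) :
    (degreeE (rep := Den n) (adjacency H) v).val = H.degree v := by
  rw [val_degreeE, countP_finRange, ← H.card_neighborFinset_eq_degree, H.neighborFinset_eq_filter]
  simp [adjacency]

theorem val_rankE_adjacency (v : Fin n) :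
    (rankE (rep := Den n) (adjacency H) v).val = rank (degreeKey H) v := by
  rw [val_rankE, countP_finRange, rank]
  simp [val_degreeE_adjacency, degreeKey, Prod.Lex.toLex_lt_toLex]

theorem mem_topDegreeE_adjacency {r : ℕ} {v : Fin n} :
    v ∈ (topDegreeE (rep := Den n) (adjacency H) r).val ↔ rank (degreeKey H) v < r := by
  simp only [val_topDegreeE, List.mem_filter, List.mem_finRange, val_rankE_adjacency,
    decide_eq_true_eq, true_and]

theorem nodup_topDegreeE (M : BoolMatrix n) (r : ℕ) :
    (topDegreeE (rep := Den n) M r).val.Nodup := by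
  rw [val_topDegreeE]
  exact (List.nodup_finRange n).filter _

omit [DecidableRel H.Adj] in
theorem length_topDegreeE_adjacency {r : ℕ} (hr : r ≤ n) :
    (topDegreeE (rep := Den n) (adjacency H) r).val.length = r := by
  classical
  rw [← List.toFinset_card_of_nodup (nodup_topDegreeE _ r)]
  convert card_rank_lt (degreeKey_injective H) (hr.trans_eq (Fintype.card_fin n).symm) using 2
  ext v
  rw [List.mem_toFinset, Finset.mem_filter_univ]
  exact mem_topDegreeE_adjacency H

theorem degree_le_of_mem_topDegreeE {r : ℕ} {u v : Fin n}
    (hv : v ∈ (topDegreeE (rep := Den n) (adjacency H) r).val)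
    (hu : u ∉ (topDegreeE (rep := Den n) (adjacency H) r).val) : H.degree u ≤ H.degree v := by
  rw [mem_topDegreeE_adjacency] at hv hu
  have hlt : rank (degreeKey H) v < rank (degreeKey H) u := hv.trans_le (not_lt.1 hu)
  exact degree_le_of_degreeKey_le H (rank_lt_rank_iff.1 hlt).le

end TopDegree

section CommonNeighbors

open Finset

theorem le_choose_succ_add (d q : ℕ) : d ≤ d.choose (q + 1) + q := by
  induction d with
  | zero => omega
  | succ d ih =>
    by_cases h : q ≤ d
    · have := Nat.choose_pos h
      rw [Nat.choose_succ_succ']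
      omega
    · omega

variable {V : Type*} [Fintype V]

theorem card_mul_sum_le_card_mul_sum {R : Finset V} {d : V → ℕ}
    (htop : ∀ v ∈ R, ∀ u ∉ R, d u ≤ d v) : #R * ∑ v, d v ≤ Fintype.card V * ∑ v ∈ R, d v := by
  classical
  have hcompl : #R * ∑ u ∈ Rᶜ, d u ≤ #Rᶜ * ∑ v ∈ R, d v := by
    calc #R * ∑ u ∈ Rᶜ, d u = ∑ _ ∈ R, ∑ u ∈ Rᶜ, d u := by rw [sum_const, smul_eq_mul]
      _ ≤ ∑ v ∈ R, ∑ _ ∈ Rᶜ, d v :=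
        sum_le_sum fun v hv => sum_le_sum fun u hu => htop v hv u (mem_compl.1 hu)
      _ = #Rᶜ * ∑ v ∈ R, d v := by simp only [sum_const, smul_eq_mul, mul_sum]
  rw [← sum_add_sum_compl R d, ← card_add_card_compl R, mul_add, add_mul]
  exact Nat.add_le_add_left hcompl _

variable [DecidableEq V] (H : SimpleGraph V) [DecidableRel H.Adj] (R : Finset V)

/-- The intersection of the sets `N(v) \ R` over all `v ∈ C`. -/
def commonNbrs (C : Finset V) : Finset V := {w | w ∉ R ∧ ∀ v ∈ C, H.Adj v w}

theorem sum_card_commonNbrs (q : ℕ) :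
    ∑ C ∈ R.powersetCard q, #(commonNbrs H R C) = ∑ w ∈ Rᶜ, (#{v ∈ R | H.Adj v w}).choose q := by
  convert sum_card_bipartiteAbove_eq_sum_card_bipartiteBelow (s := R.powersetCard q) (t := Rᶜ)
    (fun C w => ∀ v ∈ C, H.Adj v w) using 2 with C _ w _
  · congr 1
    ext w
    simp [commonNbrs, bipartiteAbove]
  · rw [← card_powersetCard]
    congr 1
    ext C
    simp only [bipartiteBelow, mem_filter, mem_powersetCard, subset_iff]
    grind

theorem sum_degree_le :
    ∑ v ∈ R, H.degree v ≤ ∑ w ∈ Rᶜ, #{v ∈ R | H.Adj v w} + #R ^ 2 := by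
  have hdegree (v : V) : H.degree v ≤ #(bipartiteAbove H.Adj Rᶜ v) + #R := by
    calc H.degree v = #(H.neighborFinset v) := (H.card_neighborFinset_eq_degree v).symm
      _ ≤ #(bipartiteAbove H.Adj Rᶜ v ∪ R) := by
        refine card_le_card fun w hw => ?_
        simp only [SimpleGraph.mem_neighborFinset] at hw
        simp only [bipartiteAbove, mem_union, mem_filter, mem_compl, hw, and_true]
        tauto
      _ ≤ _ := card_union_le _ _
  calc ∑ v ∈ R, H.degree v ≤ ∑ v ∈ R, (#(bipartiteAbove H.Adj Rᶜ v) + #R) :=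
        sum_le_sum fun v _ => hdegree v
    _ = _ := by
      rw [sum_add_distrib, sum_const, smul_eq_mul, ← sq,
        sum_card_bipartiteAbove_eq_sum_card_bipartiteBelow]
      rfl

variable {H R}

theorem card_mul_card_edgeFinset_le {q s : ℕ} (htop : ∀ v ∈ R, ∀ u ∉ R, H.degree u ≤ H.degree v)
    (hs : ∀ C ∈ R.powersetCard (q + 1), #(commonNbrs H R C) ≤ s) :
    #R * (2 * #H.edgeFinset) ≤
      Fintype.card V * (s * (#R).choose (q + 1) + Fintype.card V * q + #R ^ 2) := by
  have hcross : ∑ w ∈ Rᶜ, #{v ∈ R | H.Adj v w} ≤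
      s * (#R).choose (q + 1) + Fintype.card V * q := by
    calc ∑ w ∈ Rᶜ, #{v ∈ R | H.Adj v w}
        ≤ ∑ w ∈ Rᶜ, ((#{v ∈ R | H.Adj v w}).choose (q + 1) + q) :=
          sum_le_sum fun w _ => le_choose_succ_add _ _
      _ = ∑ C ∈ R.powersetCard (q + 1), #(commonNbrs H R C) + #Rᶜ * q := by
          rw [sum_add_distrib, sum_card_commonNbrs, sum_const, smul_eq_mul]
      _ ≤ s * (#R).choose (q + 1) + Fintype.card V * q := by
          gcongr
          · rw [← card_powersetCard, mul_comm, ← smul_eq_mul]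
            exact sum_le_card_nsmul _ _ _ hs
          · exact card_le_univ _
  calc #R * (2 * #H.edgeFinset) = #R * ∑ v, H.degree v := by
        rw [H.sum_degrees_eq_twice_card_edges]
    _ ≤ Fintype.card V * ∑ v ∈ R, H.degree v := card_mul_sum_le_card_mul_sum htop
    _ ≤ Fintype.card V * (∑ w ∈ Rᶜ, #{v ∈ R | H.Adj v w} + #R ^ 2) := by
        gcongr
        exact sum_degree_le H R
    _ ≤ _ := by gcongr

end CommonNeighbors

section Parameters

open Real

theorem sum_choose_le {r q : ℕ} {x : ℝ} (hx : 0 < x) (hx1 : x ≤ 1) (hr : r * x ≤ q) :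
    ∑ i ∈ Finset.range (q + 1), (r.choose i : ℝ) ≤ (exp 1 / x) ^ q := by
  rw [div_pow, le_div_iff₀ (by positivity), ← exp_nat_mul, mul_one, Finset.sum_mul]
  calc ∑ i ∈ Finset.range (q + 1), (r.choose i : ℝ) * x ^ q
      ≤ ∑ i ∈ Finset.range (q + 1), (r.choose i : ℝ) * x ^ i :=
        Finset.sum_le_sum fun i hi => mul_le_mul_of_nonneg_left
          (pow_le_pow_of_le_one hx.le hx1 (Finset.mem_range_succ_iff.1 hi)) (Nat.cast_nonneg _)
    _ ≤ ∑ i ∈ Finset.range (q + r + 1), (r.choose i : ℝ) * x ^ i :=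
        Finset.sum_le_sum_of_subset_of_nonneg (Finset.range_subset_range.2 (by omega))
          fun _ _ _ => by positivity
    _ = ∑ i ∈ Finset.range (r + 1), (r.choose i : ℝ) * x ^ i := by
        refine (Finset.sum_subset (Finset.range_subset_range.2 (by omega)) fun i _ hi => ?_).symm
        rw [Nat.choose_eq_zero_of_lt (by simpa using hi), Nat.cast_zero, zero_mul]
    _ = (x + 1) ^ r := by simp only [add_pow, one_pow, mul_one, mul_comm]
    _ ≤ exp x ^ r := by gcongr; exact add_one_le_exp x
    _ = exp (r * x) := (exp_nat_mul x r).symm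
    _ ≤ exp q := exp_le_exp.2 hr

/-- The numbers `n` of vertices for which the estimates of the parameters `q` and `r` hold. -/
structure IsLarge (n : ℕ) : Prop where
  four_le : 4 ≤ n
  log_le : 2 * exp 1 * log n ≤ n / 2
  log_pow_le : 2 * log n ^ 4 ≤ n

theorem eventually_isLarge : ∀ᶠ n : ℕ in Filter.atTop, IsLarge n := by
  have hlog : ∀ᶠ x : ℝ in Filter.atTop, log x ≤ 1 / (4 * exp 1) * x := by
    have hbound := isLittleO_log_id_atTop.bound (show 0 < 1 / (4 * exp 1) by positivity)
    filter_upwards [hbound, Filter.eventually_ge_atTop 0] with x hx hx0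
    simpa only [id, norm_eq_abs, abs_of_nonneg hx0] using (le_abs_self _).trans hx
  have hlog4 : ∀ᶠ x : ℝ in Filter.atTop, log x ^ 4 ≤ 1 / 2 * x := by
    have hbound := (isLittleO_pow_log_id_atTop (n := 4)).bound (show (0 : ℝ) < 1 / 2 by norm_num)
    filter_upwards [hbound, Filter.eventually_ge_atTop 0] with x hx hx0
    simpa only [id, norm_eq_abs, abs_of_nonneg hx0] using (le_abs_self _).trans hx
  filter_upwards [tendsto_natCast_atTop_atTop.eventually (hlog.and hlog4),
    Filter.eventually_ge_atTop 4] with n hn hn4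
  refine ⟨hn4, ?_, by linarith [hn.2]⟩
  calc 2 * exp 1 * log n ≤ 2 * exp 1 * (1 / (4 * exp 1) * n) := by gcongr; exact hn.1
    _ = n / 2 := by field_simp; ring

namespace IsLarge

variable {n : ℕ} (h : IsLarge n)
include h

theorem cast_pos : (0 : ℝ) < n := by exact_mod_cast (show 0 < n by linarith [h.four_le])

theorem one_lt_log : 1 < log n := by
  have : (4 : ℝ) ≤ n := by exact_mod_cast h.four_le
  rw [lt_log_iff_exp_lt h.cast_pos]
  linarith [exp_one_lt_d9]

theorem log_le_two_mul_log_half : log n ≤ 2 * log ((n : ℝ) / 2) := by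
  have hn : (4 : ℝ) ≤ n := by exact_mod_cast h.four_le
  rw [← log_rpow (by linarith), rpow_two]
  exact log_le_log h.cast_pos (by nlinarith)

end IsLarge

/-- The pairs `(n, m)` for which FIND-BIPARTITE is analysed: some graph with `n` vertices and `m`
edges, `n` being large, passes the density test of the main loop. -/
structure IsDenseSize (n m : ℕ) : Prop where
  isLarge : IsLarge n
  two_mul_le : 2 * m ≤ n ^ 2
  isDense : isDense n m = true

/-- The number `2 e n² / m` whose logarithm is the denominator in the definition of `q`. -/
noncomputable def qBase (n m : ℕ) : ℝ := 2 * exp 1 * n ^ 2 / m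

theorem qParam_eq_floor (n m : ℕ) :
    qParam n m = ⌊log ((n : ℝ) / 2) / log (qBase n m)⌋₊ := rfl

namespace IsDenseSize

variable {n m : ℕ} (h : IsDenseSize n m)
include h

theorem div_log_lt : (n : ℝ) ^ 2 / log n < m := by simpa [Biclique.isDense] using h.isDense

theorem cast_pos : (0 : ℝ) < m := by
  have := h.isLarge.one_lt_log
  exact h.div_log_lt.trans_le' (by positivity)

theorem sq_div_le_log : (n : ℝ) ^ 2 / m ≤ log n := by
  have hlt := h.div_log_lt
  rw [div_lt_iff₀ (by linarith [h.isLarge.one_lt_log])] at hlt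
  rw [div_le_iff₀ h.cast_pos]
  linarith

theorem two_le_sq_div : 2 ≤ (n : ℝ) ^ 2 / m := by
  rw [le_div_iff₀ h.cast_pos]
  exact_mod_cast h.two_mul_le

theorem exp_one_le_qBase : exp 1 ≤ qBase n m := by
  have := h.two_le_sq_div
  rw [qBase, mul_div_assoc]
  nlinarith [exp_pos 1]

theorem qBase_le : qBase n m ≤ n / 2 := by
  calc qBase n m = 2 * exp 1 * ((n : ℝ) ^ 2 / m) := mul_div_assoc _ _ _
    _ ≤ 2 * exp 1 * log n := by gcongr; exact h.sq_div_le_log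
    _ ≤ n / 2 := h.isLarge.log_le

theorem qBase_pos : 0 < qBase n m := (exp_pos 1).trans_le h.exp_one_le_qBase

theorem one_le_log_qBase : 1 ≤ log (qBase n m) :=
  (le_log_iff_exp_le h.qBase_pos).2 h.exp_one_le_qBase

theorem one_le_log_half_div : 1 ≤ log ((n : ℝ) / 2) / log (qBase n m) := by
  rw [one_le_div (by linarith [h.one_le_log_qBase])]
  exact log_le_log h.qBase_pos h.qBase_le

theorem qParam_pos : 0 < qParam n m := by
  rw [qParam_eq_floor]
  exact Nat.floor_pos.2 h.one_le_log_half_div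

theorem qParam_mul_log_le : qParam n m * log (qBase n m) ≤ log ((n : ℝ) / 2) := by
  rw [← le_div_iff₀ (by linarith [h.one_le_log_qBase]), qParam_eq_floor]
  exact Nat.floor_le (by linarith [h.one_le_log_half_div])

theorem log_half_le : log ((n : ℝ) / 2) ≤ 2 * qParam n m * log (qBase n m) := by
  have hlog := h.one_le_log_qBase
  have hfloor : log ((n : ℝ) / 2) / log (qBase n m) < qParam n m + 1 := Nat.lt_floor_add_one _
  have hq : (1 : ℝ) ≤ qParam n m := by exact_mod_cast h.qParam_pos
  rw [div_lt_iff₀ (by linarith)] at hfloor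
  nlinarith

theorem qBase_pow_le : qBase n m ^ qParam n m ≤ n / 2 := by
  have := h.isLarge.cast_pos
  rw [← log_le_log_iff (pow_pos h.qBase_pos _) (by positivity), log_pow]
  exact h.qParam_mul_log_le

theorem qParam_le_log : qParam n m ≤ log n := by
  have hn := h.isLarge.cast_pos
  calc (qParam n m : ℝ) ≤ qParam n m * log (qBase n m) :=
        le_mul_of_one_le_right (Nat.cast_nonneg _) h.one_le_log_qBase
    _ ≤ log ((n : ℝ) / 2) := h.qParam_mul_log_le
    _ ≤ log n := log_le_log (by linarith) (by linarith)

theorem qParam_le : qParam n m ≤ n := by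
  have : (qParam n m : ℝ) ≤ n := by
    linarith [h.qParam_le_log, log_le_sub_one_of_pos h.isLarge.cast_pos]
  exact_mod_cast this

theorem rParam_mul_le : rParam n m * m ≤ qParam n m * n ^ 2 := by
  have hfloor : (rParam n m : ℝ) ≤ qParam n m * (n : ℝ) ^ 2 / m := Nat.floor_le (by positivity)
  rw [le_div_iff₀ h.cast_pos] at hfloor
  exact_mod_cast hfloor

theorem qParam_mul_lt : qParam n m * n ^ 2 < (rParam n m + 1) * m := by
  have hfloor : qParam n m * (n : ℝ) ^ 2 / m < rParam n m + 1 := Nat.lt_floor_add_one _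
  rw [div_lt_iff₀ h.cast_pos] at hfloor
  exact_mod_cast hfloor

theorem rParam_le_log_sq : rParam n m ≤ log n ^ 2 := by
  have := h.isLarge.one_lt_log
  calc (rParam n m : ℝ) ≤ qParam n m * (n : ℝ) ^ 2 / m := Nat.floor_le (by positivity)
    _ = qParam n m * ((n : ℝ) ^ 2 / m) := mul_div_assoc _ _ _
    _ ≤ log n * log n :=
        mul_le_mul h.qParam_le_log h.sq_div_le_log (by positivity) (by positivity)
    _ = log n ^ 2 := (sq _).symm

theorem two_mul_rParam_sq_le : 2 * rParam n m ^ 2 ≤ n := by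
  have : (2 * rParam n m ^ 2 : ℝ) ≤ n := by
    calc (2 * rParam n m ^ 2 : ℝ) ≤ 2 * (log n ^ 2) ^ 2 := by gcongr; exact h.rParam_le_log_sq
      _ = 2 * log n ^ 4 := by ring
      _ ≤ n := h.isLarge.log_pow_le
  exact_mod_cast this

theorem rParam_le : rParam n m ≤ n := by nlinarith [h.two_mul_rParam_sq_le]

theorem two_pow_mul_sum_choose_le :
    2 * (2 ^ qParam n m * ∑ i ∈ Finset.range (qParam n m + 1), (rParam n m).choose i) ≤ n := by
  have hn := h.isLarge.cast_pos
  have hm := h.cast_pos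
  have hx1 : (m : ℝ) / n ^ 2 ≤ 1 := by
    rw [← inv_div]
    exact inv_le_one_of_one_le₀ (by linarith [h.two_le_sq_div])
  have hr : (rParam n m : ℝ) * (m / n ^ 2) ≤ qParam n m := by
    rw [← mul_div_assoc, div_le_iff₀ (by positivity)]
    exact_mod_cast h.rParam_mul_le
  have hsum : (2 : ℝ) ^ qParam n m *
      ∑ i ∈ Finset.range (qParam n m + 1), ((rParam n m).choose i : ℝ) ≤ n / 2 := by
    calc _ ≤ (2 : ℝ) ^ qParam n m * (exp 1 / (m / n ^ 2)) ^ qParam n m := by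
          gcongr
          exact sum_choose_le (by positivity) hx1 hr
      _ = qBase n m ^ qParam n m := by
          rw [← mul_pow, qBase]
          congr 1
          field_simp
      _ ≤ n / 2 := h.qBase_pow_le
  exact_mod_cast (le_div_iff₀' zero_lt_two).1 hsum

end IsDenseSize

end Parameters

section FindBipartite

variable {n : ℕ}

theorem IsDenseSize.exists_le_card_commonNbrs {H : SimpleGraph (Fin n)} [DecidableRel H.Adj]
    {R : Finset (Fin n)} (h : IsDenseSize n H.edgeSet.ncard)
    (hR : R.card = rParam n H.edgeSet.ncard) (htop : ∀ v ∈ R, ∀ u ∉ R, H.degree u ≤ H.degree v) :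
    ∃ C ∈ R.powersetCard (qParam n H.edgeSet.ncard),
      qParam n H.edgeSet.ncard ≤ (commonNbrs H R C).card := by
  set m := H.edgeSet.ncard with hm
  set r := rParam n m
  obtain ⟨k, hk⟩ : ∃ k, qParam n m = k + 1 := Nat.exists_eq_succ_of_ne_zero h.qParam_pos.ne'
  by_contra! hcon
  rw [hk] at hcon
  have hcount := card_mul_card_edgeFinset_le htop fun C hC => Nat.lt_succ_iff.1 (hcon C hC)
  rw [hR, Fintype.card_fin, ← Set.ncard_coe_finset, SimpleGraph.coe_edgeFinset, ← hm] at hcount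
  have hchoose : 2 * (k * r.choose (k + 1)) ≤ n := by
    calc 2 * (k * r.choose (k + 1))
        ≤ 2 * (2 ^ (k + 1) * ∑ i ∈ Finset.range (k + 1 + 1), r.choose i) := by
          gcongr
          · exact (Nat.le_succ k).trans Nat.lt_two_pow_self.le
          · exact Finset.single_le_sum (f := r.choose) (fun _ _ => Nat.zero_le _)
              (Finset.self_mem_range_succ _)
      _ ≤ n := hk ▸ h.two_pow_mul_sum_choose_le
  have hcross : k * r.choose (k + 1) + n * k + r ^ 2 ≤ n * (k + 1) := by
    linarith [h.two_mul_rParam_sq_le]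
  have hlt := h.qParam_mul_lt
  rw [hk] at hlt
  have hle : r * (2 * m) ≤ (k + 1) * n ^ 2 := by
    calc r * (2 * m) ≤ n * (n * (k + 1)) := hcount.trans (Nat.mul_le_mul_left n hcross)
      _ = (k + 1) * n ^ 2 := by ring
  nlinarith [h.two_mul_le, Nat.zero_le (k * n ^ 2)]

theorem nodup_commonE (M : BoolMatrix n) (R C : List (Fin n)) :
    (commonE (rep := Den n) M R C).val.Nodup := by
  rw [val_commonE]
  exact (List.nodup_finRange n).filter _

theorem adj_of_mem_commonE {H : SimpleGraph (Fin n)} {R C : List (Fin n)} {v w : Fin n}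
    (hv : v ∈ C) (hw : w ∈ (commonE (rep := Den n) (adjacency H) R C).val) : H.Adj v w := by
  rw [val_commonE, List.mem_filter] at hw
  simp only [Bool.and_eq_true, List.all_eq_true, adjacency, decide_eq_true_eq] at hw
  exact hw.2.2 v hv

theorem toFinset_commonE (H : SimpleGraph (Fin n)) [DecidableRel H.Adj] (R C : List (Fin n)) :
    (commonE (rep := Den n) (adjacency H) R C).val.toFinset =
      commonNbrs H R.toFinset C.toFinset := by
  ext w
  simp [val_commonE, commonNbrs, adjacency]

theorem reverse_sublist_of_mem_subsetsE {q : ℕ} {R C : List (Fin n)}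
    (hC : C ∈ (subsetsE (rep := Den n) q R).val) : C.reverse.Sublist R ∧ C.length = q := by
  rw [val_subsetsE, List.mem_filter, decide_eq_true_eq] at hC
  exact ⟨reverse_sublist_of_mem_collect hC.1, hC.2⟩

theorem exists_mem_subsetsE_toFinset_eq {q : ℕ} {R : List (Fin n)} (hR : R.Nodup)
    {C : Finset (Fin n)} (hC : C ∈ R.toFinset.powersetCard q) :
    ∃ S ∈ (subsetsE (rep := Den n) q R).val, S.toFinset = C := by
  obtain ⟨hCR, hcard⟩ := Finset.mem_powersetCard.1 hC
  have htoFinset : (R.filter (· ∈ C)).toFinset = C := by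
    simpa only [List.toFinset_filter, decide_eq_true_eq, Finset.filter_mem_eq_inter] using
      Finset.inter_eq_right.2 hCR
  have hlength : (R.filter (· ∈ C)).length = q := by
    rw [← List.toFinset_card_of_nodup (hR.filter _), htoFinset, hcard]
  refine ⟨(R.filter (· ∈ C)).reverse, ?_, by rw [List.toFinset_reverse, htoFinset]⟩
  rw [val_subsetsE, List.mem_filter, List.length_reverse, decide_eq_true_eq]
  exact ⟨reverse_mem_collect List.filter_sublist hlength.le, hlength⟩

theorem isBalancedBiclique_take_commonE {H : SimpleGraph (Fin n)} {q : ℕ} {R C : List (Fin n)}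
    (hq : 0 < q) (hR : R.Nodup) (hC : C ∈ (subsetsE (rep := Den n) q R).val)
    (hD : q ≤ (commonE (rep := Den n) (adjacency H) R C).val.length) :
    IsBalancedBiclique H
        (toFinsets (C, (commonE (rep := Den n) (adjacency H) R C).val.take q)) ∧
      C.toFinset.card = q := by
  obtain ⟨hsub, hlength⟩ := reverse_sublist_of_mem_subsetsE hC
  have hCcard : C.toFinset.card = q := by
    rw [List.toFinset_card_of_nodup (List.nodup_reverse.1 (hsub.nodup hR)), hlength]
  refine ⟨⟨Finset.card_pos.1 (hq.trans_eq hCcard.symm), hCcard.trans ?_, fun a ha b hb => ?_⟩,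
    hCcard⟩
  · rw [toFinsets, List.toFinset_card_of_nodup
      ((nodup_commonE _ _ _).sublist (List.take_sublist _ _)), List.length_take, min_eq_left hD]
  · exact adj_of_mem_commonE (List.mem_toFinset.1 ha)
      (List.mem_of_mem_take (List.mem_toFinset.1 hb))

theorem exists_mem_subsetsE_le_length_commonE {H : SimpleGraph (Fin n)}
    (h : IsDenseSize n H.edgeSet.ncard) :
    let q := qParam n H.edgeSet.ncard
    let R := (topDegreeE (rep := Den n) (adjacency H) (rParam n H.edgeSet.ncard)).val
    ∃ C ∈ (subsetsE (rep := Den n) q R).val,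
      q ≤ (commonE (rep := Den n) (adjacency H) R C).val.length := by
  classical
  intro q R
  have hR : R.Nodup := nodup_topDegreeE _ _
  obtain ⟨C, hC, hD⟩ := h.exists_le_card_commonNbrs (R := R.toFinset)
    (by rw [List.toFinset_card_of_nodup hR, length_topDegreeE_adjacency H h.rParam_le])
    (fun v hv u hu => degree_le_of_mem_topDegreeE H (List.mem_toFinset.1 hv)
      fun hmem => hu (List.mem_toFinset.2 hmem))
  obtain ⟨S, hS, rfl⟩ := exists_mem_subsetsE_toFinset_eq hR hC
  refine ⟨S, hS, hD.trans_eq ?_⟩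
  rw [← toFinset_commonE, List.toFinset_card_of_nodup (nodup_commonE _ _ _)]

theorem exists_val_findBipartite_eq {H : SimpleGraph (Fin n)}
    (h : IsDenseSize n H.edgeSet.ncard) :
    ∃ K : Parts n,
      (findBipartite (rep := Den n) (adjacency H) n H.edgeSet.ncard).val = [K] ∧
        IsBalancedBiclique H (toFinsets K) ∧
        (toFinsets K).1.card = qParam n H.edgeSet.ncard := by
  obtain ⟨C₀, hC₀, hD₀⟩ := exists_mem_subsetsE_le_length_commonE h
  rw [val_findBipartite]
  generalize hfind : List.find? _ _ = result
  rcases result with _ | C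
  · exact absurd hD₀ (by simpa using List.find?_eq_none.1 hfind C₀ hC₀)
  · have hD := List.find?_some hfind
    rw [Bool.not_eq_true', decide_eq_false_iff_not, not_lt] at hD
    exact ⟨_, rfl, isBalancedBiclique_take_commonE h.qParam_pos (nodup_topDegreeE _ _)
      (List.mem_of_find?_eq_some hfind) hD⟩

theorem length_of_mem_findBipartite {M : BoolMatrix n} {m : ℕ} {K : Parts n}
    (hK : K ∈ (findBipartite (rep := Den n) M n m).val) :
    K.1.length = qParam n m ∧ K.2.length ≤ qParam n m := by
  rw [val_findBipartite, Option.mem_toList, Option.map_eq_some_iff] at hK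
  obtain ⟨C, hC, rfl⟩ := hK
  exact ⟨(reverse_sublist_of_mem_subsetsE (List.mem_of_find?_eq_some hC)).2,
    List.length_take_le ..⟩

end FindBipartite

section Potential

open Real

/-- An antiderivative of `t ↦ log (A / t)`. A subgraph `K_{q,q}` found in a graph with `m` edges
costs at most `4 log (A / m) / log (n / 2)` per deleted edge with `A = 2 e n²`, so that the
potential pays for all of them. -/
noncomputable def potential (A t : ℝ) : ℝ := t * (log (A / t) + 1)

variable {A t : ℝ}

theorem sub_mul_log_le_potential_sub {m : ℝ} (hA : 0 < A) (ht : 0 ≤ t) (hm : 0 < m) :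
    (m - t) * log (A / m) ≤ potential A m - potential A t := by
  unfold potential
  rcases ht.eq_or_lt with rfl | ht
  · linarith
  · have hlog : t * log (m / t) ≤ m - t := by
      calc t * log (m / t) ≤ t * (m / t - 1) := by
            gcongr
            exact log_le_sub_one_of_pos (by positivity)
        _ = m - t := by field_simp
    rw [log_div hm.ne' ht.ne'] at hlog
    rw [log_div hA.ne' hm.ne', log_div hA.ne' ht.ne']
    linarith

theorem potential_nonneg (ht : 0 ≤ t) (htA : t ≤ A) : 0 ≤ potential A t := by
  rcases ht.eq_or_lt with rfl | ht
  · simp [potential]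
  · have : 0 ≤ log (A / t) := log_nonneg ((one_le_div ht).2 htA)
    unfold potential
    positivity

theorem potential_le (hA : 0 < A) (ht : 0 ≤ t) : potential A t ≤ A := by
  rcases ht.eq_or_lt with rfl | ht
  · simpa [potential] using hA.le
  · calc t * (log (A / t) + 1) ≤ t * (A / t) := by
          gcongr
          linarith [log_le_sub_one_of_pos (div_pos hA ht)]
      _ = A := by field_simp

end Potential

section MainLoop

open Real

variable {n : ℕ} {G H : SimpleGraph (Fin n)} {L : List (Parts n)}

/-- The body of the main loop of `findDecomposition`. -/
def roundE {rep : Ty → Type} (n : rep .nat)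
    (s : rep (.prod .matrix (.list (.prod (.list .vertex) (.list .vertex))))) :
    Expr rep (.prod .matrix (.list (.prod (.list .vertex) (.list .vertex)))) :=
  .letE (.fst (.var s)) fun M => .letE (numEdgesE M) fun m => .ite (.dense (.var n) (.var m))
    (.foldl (findBipartite M n m) (.var s) fun s K =>
      .pair (deleteE (.fst (.var s)) K) (.cons (.var K) (.snd (.var s))))
    (.var s)

/-- What the main loop on input `G` guarantees when `H` is the current graph and `L` is the list of
the subgraphs found so far. -/
structure LoopInvariant (G H : SimpleGraph (Fin n)) (L : List (Parts n)) : Prop where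
  le : H ≤ G
  isBalancedDecomposition : IsBalancedDecomposition (G \ H) (L.map toFinsets)
  complexity_le : log ((n : ℝ) / 2) * complexity (L.map toFinsets) +
      4 * potential (2 * exp 1 * n ^ 2) H.edgeSet.ncard ≤
    4 * potential (2 * exp 1 * n ^ 2) G.edgeSet.ncard

theorem LoopInvariant.init (G : SimpleGraph (Fin n)) : LoopInvariant G G [] where
  le := le_rfl
  isBalancedDecomposition := by
    rw [sdiff_self]
    exact isBalancedDecomposition_nil
  complexity_le := by simp [complexity]

theorem LoopInvariant.cons {K : Parts n} (h : LoopInvariant G H L)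
    (hm : IsDenseSize n H.edgeSet.ncard) (hK : IsBalancedBiclique H (toFinsets K))
    (hcard : (toFinsets K).1.card = qParam n H.edgeSet.ncard) :
    LoopInvariant G (H.deleteEdges (edges (toFinsets K))) (K :: L) where
  le := (SimpleGraph.deleteEdges_le _).trans h.le
  isBalancedDecomposition := h.isBalancedDecomposition.cons_of_sdiff h.le hK
  complexity_le := by
    have hncard := ncard_edgeSet_deleteEdges_add hK.edges_subset
    rw [hK.ncard_edges, hcard] at hncard
    rw [List.map_cons, hK.complexity_cons, hcard]
    set q := qParam n H.edgeSet.ncard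
    have hdeleted : (H.edgeSet.ncard - (H.deleteEdges (edges (toFinsets K))).edgeSet.ncard : ℝ) =
        (q : ℝ) ^ 2 := by
      rw [← hncard]
      push_cast
      ring
    have hn := hm.isLarge.cast_pos
    have hpotential := sub_mul_log_le_potential_sub (A := 2 * exp 1 * n ^ 2) (by positivity)
      (Nat.cast_nonneg (H.deleteEdges (edges (toFinsets K))).edgeSet.ncard) hm.cast_pos
    rw [hdeleted] at hpotential
    have hpay : log ((n : ℝ) / 2) * (2 * q) ≤
        4 * ((q : ℝ) ^ 2 * log (qBase n H.edgeSet.ncard)) := by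
      calc log ((n : ℝ) / 2) * (2 * q)
          ≤ 2 * q * log (qBase n H.edgeSet.ncard) * (2 * q) := by gcongr; exact hm.log_half_le
        _ = _ := by ring
    have hprev := h.complexity_le
    push_cast
    unfold qBase at hpay
    linarith

theorem val_roundE_of_not_isDense (hd : isDense n H.edgeSet.ncard = false) :
    (roundE (rep := Den n) n (adjacency H, L)).val = (adjacency H, L) := by
  simp only [roundE, Expr.val, val_numEdgesE_adjacency, hd, cond_false]

theorem val_roundE_of_findBipartite {K : Parts n} (hd : isDense n H.edgeSet.ncard = true)
    (hK : (findBipartite (rep := Den n) (adjacency H) n H.edgeSet.ncard).val = [K]) :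
    (roundE (rep := Den n) n (adjacency H, L)).val =
      (adjacency (H.deleteEdges (edges (toFinsets K))), K :: L) := by
  simp only [roundE, Expr.val, val_numEdgesE_adjacency, hd, cond_true, hK, List.foldl_cons,
    List.foldl_nil]
  rw [val_deleteE_adjacency (H := H) rfl]

theorem isDense_zero (n : ℕ) : isDense n 0 = false := by
  simp only [isDense, decide_eq_false_iff_not, not_lt, Nat.cast_zero]
  exact div_nonneg (sq_nonneg _) (log_natCast_nonneg n)

theorem exists_loopInvariant_foldl_roundE {β : Type*} (hn : IsLarge n) (h : LoopInvariant G H L)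
    (l : List β) (hl : isDense n H.edgeSet.ncard = true → H.edgeSet.ncard ≤ l.length) :
    ∃ (H' : SimpleGraph (Fin n)) (L' : List (Parts n)),
      l.foldl (fun s _ => (roundE (rep := Den n) n s).val) (adjacency H, L) =
          (adjacency H', L') ∧
        LoopInvariant G H' L' ∧ isDense n H'.edgeSet.ncard = false := by
  induction l generalizing H L with
  | nil =>
    refine ⟨H, L, rfl, h, Bool.eq_false_iff.2 fun hd => ?_⟩
    rw [Nat.le_zero.1 (hl hd), isDense_zero] at hd
    contradiction
  | cons x l ih =>
    rw [List.foldl_cons]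
    cases hd : isDense n H.edgeSet.ncard
    · rw [val_roundE_of_not_isDense hd]
      exact ih h fun hd' => by simp [hd] at hd'
    · have hm : IsDenseSize n H.edgeSet.ncard := ⟨hn, two_mul_ncard_edgeSet_le H, hd⟩
      obtain ⟨K, hfind, hK, hcard⟩ := exists_val_findBipartite_eq hm
      rw [val_roundE_of_findBipartite hd hfind]
      refine ih (h.cons hm hK hcard) fun _ => ?_
      have hncard := ncard_edgeSet_deleteEdges_add hK.edges_subset
      have hpos : 0 < (edges (toFinsets K)).ncard := by
        rw [hK.ncard_edges, hcard]
        exact Nat.pow_pos hm.qParam_pos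
      have hlength := hl hd
      rw [List.length_cons] at hlength
      lia

theorem val_findDecomposition (n₀ : ℕ) (M : BoolMatrix n) :
    (findDecomposition n₀ (Den n) M).val =
      bif decide (n < n₀) then (bruteForce (rep := Den n) M).val
      else
        let s := (List.range (numEdgesE (rep := Den n) M).val).foldl
          (fun s _ => (roundE (rep := Den n) n s).val) (M, [])
        (singleEdgesE (rep := Den n) s.1 (.var s.2)).val := by
  simp only [findDecomposition, Expr.val, val_lengthE, List.length_finRange]
  rfl

theorem exists_output_eq {n₀ : ℕ} (hn : IsLarge n) (hn₀ : n₀ ≤ n) (G : SimpleGraph (Fin n)) :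
    ∃ (H : SimpleGraph (Fin n)) (L : List (Parts n)),
      output n₀ G =
          (singleEdgesE (rep := Den n) (adjacency H) (.var L)).val.map toFinsets ∧
        LoopInvariant G H L ∧ isDense n H.edgeSet.ncard = false := by
  obtain ⟨H, L, hfold, hinv, hd⟩ := exists_loopInvariant_foldl_roundE hn (.init G)
    (List.range G.edgeSet.ncard) fun _ => List.length_range.ge
  refine ⟨H, L, ?_, hinv, hd⟩
  rw [output, val_findDecomposition, decide_eq_false hn₀.not_gt, cond_false,
    val_numEdgesE_adjacency]
  dsimp only
  rw [hfold]
  rfl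

theorem isBalancedDecomposition_output {n₀ : ℕ} (hn : n < n₀ ∨ IsLarge n)
    (G : SimpleGraph (Fin n)) : IsBalancedDecomposition G (output n₀ G) := by
  rcases lt_or_ge n n₀ with hlt | hle
  · rw [output, val_findDecomposition, decide_eq_true hlt, cond_true]
    exact isBalancedDecomposition_bruteForce G
  · obtain ⟨H, L, hout, hinv, -⟩ := exists_output_eq (hn.resolve_left hle.not_gt) hle G
    rw [hout]
    exact isBalancedDecomposition_singleEdgesE hinv.le hinv.isBalancedDecomposition rfl

theorem LoopInvariant.complexity_mul_log_le (hn : IsLarge n) (h : LoopInvariant G H L) :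
    complexity (L.map toFinsets) * log n ≤ 16 * exp 1 * n ^ 2 := by
  have hn0 := hn.cast_pos
  have hH : 0 ≤ potential (2 * exp 1 * n ^ 2) H.edgeSet.ncard := by
    refine potential_nonneg (Nat.cast_nonneg _) ?_
    have : (2 * H.edgeSet.ncard : ℝ) ≤ n ^ 2 := by exact_mod_cast two_mul_ncard_edgeSet_le H
    nlinarith [add_one_le_exp (1 : ℝ), sq_nonneg (n : ℝ)]
  have hG : potential (2 * exp 1 * n ^ 2) G.edgeSet.ncard ≤ 2 * exp 1 * n ^ 2 :=
    potential_le (by positivity) (Nat.cast_nonneg _)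
  calc complexity (L.map toFinsets) * log n
      ≤ complexity (L.map toFinsets) * (2 * log ((n : ℝ) / 2)) := by
        gcongr
        exact hn.log_le_two_mul_log_half
    _ ≤ 16 * exp 1 * n ^ 2 := by linarith [h.complexity_le]

theorem complexity_output_le {n₀ : ℕ} (hn : IsLarge n) (hn₀ : n₀ ≤ n) (G : SimpleGraph (Fin n)) :
    (complexity (output n₀ G) : ℝ) ≤ (2 + 16 * exp 1) * ((n : ℝ) ^ 2 / log n) := by
  obtain ⟨H, L, hout, hinv, hd⟩ := exists_output_eq hn hn₀ G
  have hH : (H.edgeSet.ncard : ℝ) ≤ (n : ℝ) ^ 2 / log n := by simpa [isDense] using hd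
  have hL : (complexity (L.map toFinsets) : ℝ) ≤ 16 * exp 1 * ((n : ℝ) ^ 2 / log n) := by
    rw [← mul_div_assoc, le_div_iff₀ (by linarith [hn.one_lt_log])]
    exact hinv.complexity_mul_log_le hn
  rw [hout, complexity_singleEdgesE H (L := L) rfl]
  push_cast
  linarith

end MainLoop

section LoopCost

theorem loopCost_le {α σ : Type} {step : σ → α → σ} {c : σ → α → ℕ} {s : σ} {l : List α} {B : ℕ}
    (h : ∀ l₁ x l₂, l = l₁ ++ x :: l₂ → c (l₁.foldl step s) x ≤ B) :
    loopCost step c s l ≤ l.length * (B + 1) := by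
  induction l generalizing s with
  | nil => simp [loopCost]
  | cons x l ih =>
    have hhead : c s x ≤ B := h [] x l rfl
    have htail := ih (s := step s x) fun l₁ y l₂ hl => h (x :: l₁) y l₂ (by rw [hl]; rfl)
    rw [loopCost, List.length_cons, Nat.succ_mul]
    lia

variable {n : ℕ} {a σ : Ty} {l : Expr (Den n) (.list a)} {init : Expr (Den n) σ}
  {f : Den n σ → Den n a → Expr (Den n) σ} {k B : ℕ}

theorem cost_foldl_le_of_prefix (hk : l.val.length ≤ k)
    (h : ∀ l₁ x l₂, l.val = l₁ ++ x :: l₂ →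
      (f (l₁.foldl (fun s x => (f s x).val) init.val) x).cost ≤ B) :
    (Expr.foldl l init f).cost ≤ 1 + l.cost + init.cost + k * (B + 1) := by
  rw [Expr.cost]
  exact Nat.add_le_add_left ((loopCost_le h).trans (Nat.mul_le_mul_right _ hk)) _

theorem cost_foldl_le_of_invariant (I : Den n σ → Prop) (hk : l.val.length ≤ k) (hI : I init.val)
    (hstep : ∀ s, ∀ x ∈ l.val, I s → I (f s x).val)
    (hcost : ∀ s, ∀ x ∈ l.val, I s → (f s x).cost ≤ B) :
    (Expr.foldl l init f).cost ≤ 1 + l.cost + init.cost + k * (B + 1) := by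
  refine cost_foldl_le_of_prefix hk fun l₁ x l₂ hl => ?_
  refine hcost _ x (by simp [hl]) (List.foldlRecOn l₁ _ hI fun s hs y hy => hstep s y ?_ hs)
  simp [hl, hy]

theorem cost_foldl_le (hk : l.val.length ≤ k) (hcost : ∀ s, ∀ x ∈ l.val, (f s x).cost ≤ B) :
    (Expr.foldl l init f).cost ≤ 1 + l.cost + init.cost + k * (B + 1) :=
  cost_foldl_le_of_invariant (fun _ => True) hk trivial (fun _ _ _ _ => trivial)
    fun s x hx _ => hcost s x hx

end LoopCost

section RoutineCost

variable {n : ℕ} {a : Ty} {k B : ℕ}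

theorem cost_nil : (Expr.nil : Expr (Den n) (.list a)).cost = 1 := by simp only [Expr.cost]

theorem cost_ite_le (b : Expr (Den n) .bool) {s t : Expr (Den n) a} (hs : s.cost ≤ B)
    (ht : t.cost ≤ B) : (Expr.ite b s t).cost ≤ 1 + b.cost + B := by
  rw [Expr.cost]
  cases b.val <;> exact Nat.add_le_add_left ‹_› _

theorem cost_andE_le (s t : Expr (Den n) .bool) : (andE s t).cost ≤ 2 + s.cost + t.cost :=
  (cost_ite_le s (B := t.cost + 1) (by lia) (by simp [Expr.cost])).trans (by lia)

theorem cost_orE_le (s t : Expr (Den n) .bool) : (orE s t).cost ≤ 2 + s.cost + t.cost :=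
  (cost_ite_le s (B := t.cost + 1) (by simp [Expr.cost]) (by lia)).trans (by lia)

theorem cost_countE_le {l : Expr (Den n) (.list a)} {p : Den n a → Expr (Den n) .bool}
    (hk : l.val.length ≤ k) (hp : ∀ x ∈ l.val, (p x).cost ≤ B) :
    (countE l p).cost ≤ 2 + l.cost + k * (B + 5) := by
  refine (cost_foldl_le hk (B := B + 4) fun s x hx => ?_).trans ?_
  · have := cost_ite_le (p x) (s := .add (.var s) (.lit 1)) (t := .var s) (B := 3)
      (by simp [Expr.cost]) (by simp [Expr.cost])
    linarith [hp x hx]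
  · simp only [Expr.cost]
    lia

theorem cost_lengthE_le {l : Expr (Den n) (.list a)} (hk : l.val.length ≤ k) :
    (lengthE l).cost ≤ 2 + l.cost + k * 4 := by
  refine (cost_foldl_le hk (B := 3) fun _ _ _ => by simp [Expr.cost]).trans ?_
  simp only [Expr.cost]
  lia

theorem cost_lengthE_var_le {S : Den n (.list a)} (hS : S.length ≤ k) :
    (lengthE (rep := Den n) (.var S)).cost ≤ 3 + k * 4 := by
  have := cost_lengthE_le (l := .var S) hS
  simp only [Expr.cost] at this
  lia

theorem cost_reverseE_le {l : Expr (Den n) (.list a)} (hk : (reverseE l).val.length ≤ k) :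
    (reverseE l).cost ≤ 2 + l.cost + k * 4 := by
  rw [val_reverseE, List.length_reverse] at hk
  refine (cost_foldl_le hk (B := 3) fun _ _ _ => by simp [Expr.cost]).trans ?_
  simp only [Expr.cost]
  lia

theorem cost_cons_ite_le {b : Expr (Den n) .bool} (x : Den n a) (acc : Den n (.list a))
    (hb : b.cost ≤ B) :
    (Expr.ite b (.cons (.var x) (.var acc)) (.var acc)).cost ≤ B + 4 := by
  refine (cost_ite_le b (B := 3) (by simp [Expr.cost]) (by simp [Expr.cost])).trans ?_
  lia

theorem cost_filterE_le {l : Expr (Den n) (.list a)} {p : Den n a → Expr (Den n) .bool}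
    (hk : l.val.length ≤ k) (hp : ∀ x ∈ l.val, (p x).cost ≤ B) :
    (filterE l p).cost ≤ 4 + l.cost + k * (B + 9) := by
  have hlength : (filterE l p).val.length ≤ k := by
    rw [val_filterE]
    exact (List.length_filter_le ..).trans hk
  refine (cost_reverseE_le hlength).trans ?_
  have hloop := cost_foldl_le (init := .nil) hk fun acc x hx => cost_cons_ite_le x acc (hp x hx)
  rw [cost_nil] at hloop
  linarith

theorem cost_takeE_le (q : ℕ) {l : Expr (Den n) (.list a)} (hk : l.val.length ≤ k) :
    (takeE (rep := Den n) q l).cost ≤ 4 + l.cost + k * (4 * q + 14) := by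
  have hlength : (takeE (rep := Den n) q l).val.length ≤ k := by
    rw [val_takeE]
    exact (List.length_take_le' ..).trans hk
  refine (cost_reverseE_le hlength).trans ?_
  have hloop := cost_foldl_le_of_invariant (l := l) (init := .nil)
    (f := fun acc x => .ite (.lt (lengthE (.var acc)) (.var q)) (.cons (.var x) (.var acc))
      (.var acc)) (B := 4 * q + 9) (fun s => List.length s ≤ q) hk (by simp [Expr.val])
    (fun s x _ hs => by
      simp only [Expr.val, val_lengthE]
      by_cases h : List.length s < q
      · simp [h]
      · simpa [h] using hs)
    (fun s x _ hs => by
      refine (cost_cons_ite_le x s (B := 4 * q + 5) ?_).trans_eq (by lia)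
      have := cost_lengthE_var_le (n := n) hs
      simp only [Expr.cost]
      lia)
  rw [cost_nil] at hloop
  linarith

theorem cost_allE_le {l : Expr (Den n) (.list a)} {p : Den n a → Expr (Den n) .bool}
    (hk : l.val.length ≤ k) (hp : ∀ x ∈ l.val, (p x).cost ≤ B) :
    (allE l p).cost ≤ 2 + l.cost + k * (B + 4) := by
  refine (cost_foldl_le hk (B := B + 3) fun s x hx => (cost_andE_le _ _).trans ?_).trans ?_
  · simp only [Expr.cost]
    linarith [hp x hx]
  · simp only [Expr.cost]
    lia

theorem cost_memE_le (v : Fin n) {l : Expr (Den n) (.list .vertex)} (hk : l.val.length ≤ k) :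
    (memE (rep := Den n) v l).cost ≤ 2 + l.cost + k * 9 := by
  refine (cost_foldl_le hk (B := 8) fun _ _ _ => (cost_orE_le _ _).trans ?_).trans ?_
  · simp [Expr.cost]
  · simp only [Expr.cost]
    lia

end RoutineCost

section GraphRoutineCost

variable {n : ℕ}

theorem length_vertices_le : (Expr.vertices (rep := Den n)).val.length ≤ n := by
  simp [Expr.val]

theorem cost_edgeE_le (M : BoolMatrix n) (u v : Fin n) :
    (edgeE (rep := Den n) M u v).cost ≤ 11 :=
  (cost_andE_le _ _).trans (by simp [Expr.cost])

theorem cost_numEdgesE_le (M : BoolMatrix n) :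
    (numEdgesE (rep := Den n) M).cost ≤ 3 + n + n * (4 + n + n * 16) := by
  have hinner (k : ℕ) (u : Fin n) :
      (Expr.foldl .vertices (.var k) fun k v => .ite (edgeE (rep := Den n) M u v)
        (.add (.var k) (.lit 1)) (.var k) : Expr (Den n) .nat).cost ≤ 3 + n + n * 16 := by
    refine (cost_foldl_le length_vertices_le (B := 15) fun k v _ => ?_).trans ?_
    · refine (cost_ite_le _ (B := 3) (by simp [Expr.cost]) (by simp [Expr.cost])).trans ?_
      linarith [cost_edgeE_le M u v]
    · simp only [Expr.cost]
      lia
  refine (cost_foldl_le length_vertices_le fun k u _ => hinner k u).trans ?_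
  simp only [Expr.cost]
  lia

theorem cost_singleEdgesE_le (M : BoolMatrix n)
    (acc : Expr (Den n) (.list (.prod (.list .vertex) (.list .vertex)))) :
    (singleEdgesE (rep := Den n) M acc).cost ≤ 2 + n + acc.cost + n * (4 + n + n * 22) := by
  have hinner (acc : List (Parts n)) (u : Fin n) :
      (Expr.foldl .vertices (.var acc) fun acc v => .ite (edgeE (rep := Den n) M u v)
        (.cons (.pair (.cons (.var u) .nil) (.cons (.var v) .nil)) (.var acc)) (.var acc) :
        Expr (Den n) (.list (.prod (.list .vertex) (.list .vertex)))).cost ≤ 3 + n + n * 22 := by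
    refine (cost_foldl_le length_vertices_le (B := 21) fun acc v _ => ?_).trans ?_
    · refine (cost_ite_le _ (B := 9) (by simp [Expr.cost]) (by simp [Expr.cost])).trans ?_
      linarith [cost_edgeE_le M u v]
    · simp only [Expr.cost]
      lia
  refine (cost_foldl_le length_vertices_le fun acc u _ => hinner acc u).trans ?_
  simp only [Expr.cost]
  lia

theorem cost_degreeE_le (M : BoolMatrix n) (v : Fin n) :
    (degreeE (rep := Den n) M v).cost ≤ 3 + n * 10 := by
  refine (cost_countE_le length_vertices_le (B := 4) fun x _ => by simp [Expr.cost]).trans ?_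
  simp only [Expr.cost]
  lia

theorem cost_rankE_le (M : BoolMatrix n) (v : Fin n) :
    (rankE (rep := Den n) M v).cost ≤ 7 + n * 11 + n * (n * 10 + 24) := by
  rw [rankE, Expr.cost]
  refine (Nat.add_le_add (Nat.add_le_add_left (cost_degreeE_le M v) _)
    (cost_countE_le length_vertices_le (B := n * 10 + 19) fun u _ => ?_)).trans ?_
  · rw [Expr.cost]
    refine (Nat.add_le_add (Nat.add_le_add_left (cost_degreeE_le M u) _) ((cost_orE_le _ _).trans
      (Nat.add_le_add_left (cost_andE_le _ _) _))).trans ?_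
    simp only [Expr.cost]
    lia
  · simp only [Expr.cost]
    linarith

theorem cost_topDegreeE_le (M : BoolMatrix n) (r : ℕ) :
    (topDegreeE (rep := Den n) M r).cost ≤ 5 + n + n * (18 + n * 11 + n * (n * 10 + 24)) := by
  refine (cost_filterE_le length_vertices_le (B := 9 + n * 11 + n * (n * 10 + 24))
    fun v _ => ?_).trans ?_
  · simp only [Expr.cost]
    linarith [cost_rankE_le M v]
  · simp only [Expr.cost]
    linarith

theorem cost_commonE_le (M : BoolMatrix n) {R C : List (Fin n)} (hR : R.length ≤ n)
    (hC : C.length ≤ n) :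
    (commonE (rep := Den n) M R C).cost ≤ 5 + n + n * (n * 17 + 17) := by
  refine (cost_filterE_le length_vertices_le (B := n * 17 + 8) fun w _ => ?_).trans ?_
  · have hall := cost_allE_le (l := .var C) (p := fun v => .read (.var M) (.var v) (.var w))
      (B := 4) (by simpa only [Expr.val] using hC) fun v _ => by simp [Expr.cost]
    have hmem := cost_memE_le w (l := .var R) (by simpa only [Expr.val] using hR)
    have hite := cost_ite_le (memE w (.var R)) (s := .ff) (B := 3 + n * 8)
      (by simp only [Expr.cost]; lia) (hall.trans (by simp only [Expr.cost]; lia))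
    simp only [Expr.cost] at hmem
    linarith
  · simp only [Expr.cost]
    linarith

theorem cost_deleteE_le (M : Expr (Den n) .matrix) {K : Parts n} (hK₁ : K.1.length ≤ n)
    (hK₂ : K.2.length ≤ n) :
    (deleteE (rep := Den n) M K).cost ≤ 3 + M.cost + n * (n * 10 + 5) := by
  have hinner (M : BoolMatrix n) (a : Fin n) :
      (Expr.foldl (.snd (.var (a := .prod (.list .vertex) (.list .vertex)) K)) (.var M)
        fun M b => .write (.write (.var M) (.var a) (.var b) .ff) (.var b) (.var a) .ff :
        Expr (Den n) .matrix).cost ≤ 4 + n * 10 := by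
    refine (cost_foldl_le (by simpa only [Expr.val] using hK₂) (B := 9)
      fun _ _ _ => by simp [Expr.cost]).trans ?_
    simp only [Expr.cost]
    lia
  refine (cost_foldl_le (by simpa only [Expr.val] using hK₁) fun M a _ => hinner M a).trans ?_
  simp only [Expr.cost]
  lia

end GraphRoutineCost

section RunningTime

variable {n m : ℕ}

theorem IsLarge.four_mul_pow_le (hn : IsLarge n) (k l : ℕ) (hkl : k + 1 = l) :
    4 * n ^ k ≤ n ^ l := by
  rw [← hkl, pow_succ']
  exact Nat.mul_le_mul_right _ hn.four_le

theorem IsDenseSize.length_collect_le (h : IsDenseSize n m) {α : Type*} {R : List α}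
    (hR : R.length ≤ rParam n m) :
    (collect (fun S => decide (S.length < qParam n m)) R).length ≤ n := by
  rw [length_collect_length_lt]
  calc ∑ i ∈ Finset.range (qParam n m + 1), R.length.choose i
      ≤ ∑ i ∈ Finset.range (qParam n m + 1), (rParam n m).choose i :=
        Finset.sum_le_sum fun i _ => Nat.choose_le_choose i hR
    _ ≤ 2 * (2 ^ qParam n m * ∑ i ∈ Finset.range (qParam n m + 1), (rParam n m).choose i) :=
        (Nat.le_mul_of_pos_left _ (by positivity)).trans (Nat.le_mul_of_pos_left _ two_pos)
    _ ≤ n := h.two_pow_mul_sum_choose_le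

theorem length_le_of_mem_collect {α : Type*} {p : List α → Bool} {R S : List α}
    (hS : S ∈ collect p R) : S.length ≤ R.length :=
  S.length_reverse ▸ (reverse_sublist_of_mem_collect hS).length_le

theorem cost_extendE_le (k : ℕ) {acc : List (List (Fin n))} (x : Fin n) (hacc : acc.length ≤ n)
    (hS : ∀ S ∈ acc, S.length ≤ n) :
    (extendE (rep := Den n) k acc x).cost ≤ 3 + n * (n * 4 + 12) := by
  refine (cost_foldl_le (by simpa only [Expr.val] using hacc) (B := n * 4 + 11)
    fun acc' S hSacc => ?_).trans ?_
  · refine (cost_ite_le _ (B := 5) (by simp [Expr.cost]) (by simp [Expr.cost])).trans ?_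
    have := cost_lengthE_var_le (n := n) (hS S (by simpa only [Expr.val] using hSacc))
    simp only [Expr.cost]
    linarith
  · simp only [Expr.cost]
    linarith

theorem IsDenseSize.cost_subsetsE_le (h : IsDenseSize n m) {R : List (Fin n)}
    (hR : R.length ≤ rParam n m) :
    (subsetsE (rep := Den n) (qParam n m) R).cost ≤
      9 + n * (4 + n * (n * 4 + 12)) + n * (n * 4 + 14) := by
  have hRn := hR.trans h.rParam_le
  have hval : (Expr.foldl (.var R) (.cons .nil .nil) (extendE (rep := Den n) (qParam n m))).val =
      collect (fun S => decide (S.length < qParam n m)) R := by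
    simp only [Expr.val]
    exact foldl_val_extendE ..
  have hloop : (Expr.foldl (.var R) (.cons .nil .nil)
      (extendE (rep := Den n) (qParam n m))).cost ≤ 5 + n * (4 + n * (n * 4 + 12)) := by
    refine (cost_foldl_le_of_prefix (by simpa only [Expr.val] using hRn)
      (B := 3 + n * (n * 4 + 12)) fun R₁ x R₂ hR₁ => ?_).trans ?_
    · replace hR₁ : R₁.length ≤ R.length := by
        simp only [Expr.val] at hR₁
        simp [hR₁]
      simp only [Expr.val]
      exact (congrArg (fun acc => (extendE (rep := Den n) (qParam n m) acc x).cost)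
        (foldl_val_extendE _ R₁)).trans_le <|
        cost_extendE_le _ x (h.length_collect_le (hR₁.trans hR)) fun S hS =>
          (length_le_of_mem_collect hS).trans (hR₁.trans hRn)
    · simp only [Expr.cost]
      linarith
  refine (cost_filterE_le (k := n) (B := 5 + n * 4) ?_ fun S hS => ?_).trans ?_
  · exact hval ▸ h.length_collect_le hR
  · have hlength := (length_le_of_mem_collect (hval ▸ hS)).trans hRn
    have := cost_lengthE_var_le (n := n) hlength
    simp only [Expr.cost]
    linarith
  · exact (Nat.add_le_add_right (Nat.add_le_add_left hloop _) _).trans (by linarith)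

/-- The body of the loop of `findBipartite`. -/
def searchE {rep : Ty → Type} (M : rep .matrix) (q : rep .nat) (R : rep (.list .vertex))
    (res : rep (.list (.prod (.list .vertex) (.list .vertex)))) (C : rep (.list .vertex)) :
    Expr rep (.list (.prod (.list .vertex) (.list .vertex))) :=
  .ite (.eq (lengthE (.var res)) (.lit 0))
    (.letE (commonE M R C) fun D => .ite (.lt (lengthE (.var D)) (.var q)) .nil
      (.cons (.pair (.var C) (takeE q (.var D))) .nil))
    (.var res)

theorem length_val_searchE_le (M : BoolMatrix n) (q : ℕ) (R C : List (Fin n))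
    {res : List (Parts n)} (hres : res.length ≤ 1) :
    (searchE (rep := Den n) M q R res C).val.length ≤ 1 := by
  simp only [searchE, Expr.val, val_lengthE]
  by_cases h₀ : res.length = 0
  · by_cases hD : List.length (commonE (rep := Den n) M R C).val < q <;> simp [h₀, hD]
  · simpa [h₀] using hres

theorem cost_searchE_le (M : BoolMatrix n) {q : ℕ} (hq : q ≤ n) {R C : List (Fin n)}
    {res : List (Parts n)} (hR : R.length ≤ n) (hC : C.length ≤ n) (hres : res.length ≤ 1) :
    (searchE (rep := Den n) M q R res C).cost ≤ 35 + n * 5 + n * (n * 17 + 17) +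
      n * (n * 4 + 14) := by
  have hD : List.length (commonE (rep := Den n) M R C).val ≤ n := by
    rw [val_commonE]
    simpa using List.length_filter_le _ (List.finRange n)
  have htake : (takeE (rep := Den n) q (.var (commonE (rep := Den n) M R C).val)).cost ≤
      5 + n * (n * 4 + 14) := by
    refine (cost_takeE_le q (by simpa only [Expr.val] using hD)).trans ?_
    simp only [Expr.cost]
    nlinarith
  have hcommon := cost_commonE_le M hR hC
  have hlength := cost_lengthE_var_le (n := n) hD
  refine (cost_ite_le _ (B := 23 + n * 5 + n * (n * 17 + 17) + n * (n * 4 + 14)) ?_ ?_).trans ?_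
  · rw [Expr.cost]
    refine (Nat.add_le_add (Nat.add_le_add_left hcommon _) (cost_ite_le _
      (B := 9 + n * (n * 4 + 14)) (by simp only [Expr.cost]; lia) ?_)).trans ?_
    · simp only [Expr.cost]
      linarith
    · simp only [Expr.cost]
      linarith
  · simp only [Expr.cost]
    lia
  · have := cost_lengthE_var_le (n := n) (a := .prod (.list .vertex) (.list .vertex)) hres
    simp only [Expr.cost]
    linarith

theorem cost_findBipartite_eq (M : BoolMatrix n) (m : ℕ) :
    let q := qParam n m
    let R := (topDegreeE (rep := Den n) M (rParam n m)).val
    (findBipartite (rep := Den n) M n m).cost =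
      9 + (topDegreeE (rep := Den n) M (rParam n m)).cost +
        (Expr.foldl (subsetsE (rep := Den n) q R) .nil (searchE M q R)).cost := by
  change (Expr.letE (.q (.var n) (.var m)) fun q => .letE (.r (.var n) (.var m)) fun r =>
    .letE (topDegreeE M r) fun R => .foldl (subsetsE q R) .nil (searchE (rep := Den n) M q R)).cost
      = _
  simp only [Expr.cost, Expr.val]
  ring

theorem IsDenseSize.cost_findBipartite_le (h : IsDenseSize n m) (H : SimpleGraph (Fin n)) :
    (findBipartite (rep := Den n) (adjacency H) n m).cost ≤ 64 * n ^ 3 := by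
  set R := (topDegreeE (rep := Den n) (adjacency H) (rParam n m)).val with hR
  have hRlen : R.length ≤ rParam n m := (length_topDegreeE_adjacency H h.rParam_le).le
  have hRn := hRlen.trans h.rParam_le
  have hlength : List.length (subsetsE (rep := Den n) (qParam n m) R).val ≤ n := by
    rw [val_subsetsE]
    exact (List.length_filter_le ..).trans (h.length_collect_le hRlen)
  have hloop := cost_foldl_le_of_invariant (init := .nil)
    (f := searchE (rep := Den n) (adjacency H) (qParam n m) R) (fun res => List.length res ≤ 1)
    hlength (by simp [Expr.val]) (fun _ C _ hres => length_val_searchE_le _ _ R C hres)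
    fun _ C hC hres => cost_searchE_le _ h.qParam_le hRn
      ((reverse_sublist_of_mem_subsetsE hC).2.trans_le h.qParam_le) hres
  rw [cost_nil] at hloop
  have htop := cost_topDegreeE_le (adjacency H) (rParam n m)
  have hsub := h.cost_subsetsE_le hRlen
  rw [cost_findBipartite_eq, ← hR]
  linarith [h.isLarge.four_le, h.isLarge.four_mul_pow_le 1 2 rfl,
    h.isLarge.four_mul_pow_le 2 3 rfl]

theorem cost_roundE_le (hn : IsLarge n) (H : SimpleGraph (Fin n)) (L : List (Parts n)) :
    (roundE (rep := Den n) n (adjacency H, L)).cost ≤ 80 * n ^ 3 := by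
  have hnum := cost_numEdgesE_le (adjacency H)
  simp only [roundE, Expr.cost, Expr.val, val_numEdgesE_adjacency]
  cases hd : isDense n H.edgeSet.ncard
  · simp only [cond_false]
    linarith [hn.four_le, hn.four_mul_pow_le 1 2 rfl,
      hn.four_mul_pow_le 2 3 rfl]
  · have hm : IsDenseSize n H.edgeSet.ncard := ⟨hn, two_mul_ncard_edgeSet_le H, hd⟩
    have hfind := hm.cost_findBipartite_le H
    obtain ⟨K, hK, -⟩ := exists_val_findBipartite_eq hm
    obtain ⟨hK₁, hK₂⟩ := length_of_mem_findBipartite (hK ▸ List.mem_singleton_self K)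
    have hdel := cost_deleteE_le
      (.fst (.var (a := .prod .matrix (.list (.prod (.list .vertex) (.list .vertex))))
        (adjacency H, L))) (hK₁.trans_le hm.qParam_le) (hK₂.trans hm.qParam_le)
    rw [hK]
    simp only [cond_true, loopCost, Expr.cost] at hdel ⊢
    linarith [hn.four_le, hn.four_mul_pow_le 1 2 rfl,
      hn.four_mul_pow_le 2 3 rfl]

theorem exists_val_roundE_eq (hn : IsLarge n) (H : SimpleGraph (Fin n)) (L : List (Parts n)) :
    ∃ (H' : SimpleGraph (Fin n)) (L' : List (Parts n)),
      (roundE (rep := Den n) n (adjacency H, L)).val = (adjacency H', L') := by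
  cases hd : isDense n H.edgeSet.ncard
  · exact ⟨H, L, val_roundE_of_not_isDense hd⟩
  · obtain ⟨K, hK, -⟩ := exists_val_findBipartite_eq ⟨hn, two_mul_ncard_edgeSet_le H, hd⟩
    exact ⟨_, _, val_roundE_of_findBipartite hd hK⟩

theorem runningTime_le {n₀ : ℕ} (hn : IsLarge n) (hn₀ : n₀ ≤ n) (G : SimpleGraph (Fin n)) :
    runningTime n₀ G ≤ 100 * n ^ 5 := by
  have hround : (Expr.foldl (.range (numEdgesE (adjacency G))) (.pair (.var (adjacency G)) .nil)
      fun s _ => roundE (rep := Den n) n s).cost ≤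
      8 + n * 5 + n ^ 2 * 18 + n ^ 2 * (80 * n ^ 3 + 1) := by
    have hm : G.edgeSet.ncard ≤ n ^ 2 := by linarith [two_mul_ncard_edgeSet_le G]
    refine (cost_foldl_le_of_invariant (fun s => ∃ H L, s = (adjacency H, L)) (k := n ^ 2) ?_
      ⟨G, [], by simp only [Expr.val]⟩ ?_ ?_ (B := 80 * n ^ 3)).trans ?_
    · simpa only [Expr.val, List.length_range, val_numEdgesE_adjacency] using hm
    · rintro _ _ - ⟨H, L, rfl⟩
      exact exists_val_roundE_eq hn H L
    · rintro _ _ - ⟨H, L, rfl⟩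
      exact cost_roundE_le hn H L
    · have := cost_numEdgesE_le (adjacency G)
      simp only [Expr.cost, val_numEdgesE_adjacency]
      linarith
  have hlength := cost_lengthE_le (n := n) length_vertices_le
  have hval : (lengthE (rep := Den n) .vertices).val = n := by
    rw [val_lengthE, Expr.val, List.length_finRange]
  have hlt : (Expr.lt (rep := Den n) (.var (a := .nat) n) (.lit n₀)).val = false := by
    simp only [Expr.val]
    exact decide_eq_false hn₀.not_gt
  change (Expr.letE (lengthE .vertices) fun k => .ite (.lt (.var k) (.lit n₀))
    (bruteForce (adjacency G)) (.letE (.foldl (.range (numEdgesE (adjacency G)))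
      (.pair (.var (adjacency G)) .nil) fun s _ => roundE k s)
        fun s => .letE (.fst (.var s)) fun M => singleEdgesE M (.snd (.var s)))).cost ≤ _
  rw [Expr.cost, hval, Expr.cost, hlt, cond_false, Expr.cost]
  generalize Expr.foldl (.range (numEdgesE (adjacency G))) (.pair (.var (adjacency G)) .nil)
    (fun s _ => roundE (rep := Den n) n s) = loop at hround ⊢
  have hsingle := cost_singleEdgesE_le loop.val.1 (.snd (.var loop.val))
  simp only [Expr.cost, Expr.val] at hsingle hlength ⊢
  linarith [hn.four_le, hn.four_mul_pow_le 1 2 rfl,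
    hn.four_mul_pow_le 2 3 rfl,
    hn.four_mul_pow_le 3 4 rfl, hn.four_mul_pow_le 4 5 rfl]

end RunningTime

section SmallGraphs

theorem exists_forall_lt_le (n₀ : ℕ) (f : ∀ n, SimpleGraph (Fin n) → ℕ) :
    ∃ B, ∀ n < n₀, ∀ G, f n G ≤ B := by
  obtain ⟨B, hB⟩ := (Set.finite_range fun x : Σ n : Fin n₀, SimpleGraph (Fin n) =>
    f x.1 x.2).bddAbove
  exact ⟨B, fun n hn G => hB ⟨⟨⟨n, hn⟩, G⟩, rfl⟩⟩

theorem one_le_sq_div_log {x : ℝ} (hx : 1 < x) : 1 ≤ x ^ 2 / Real.log x := by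
  rw [one_le_div (Real.log_pos hx)]
  linarith [Real.log_le_sub_one_of_pos (zero_lt_one.trans hx), sq_nonneg (x - 1)]

end SmallGraphs

end Biclique

theorem theorem2 :
    ∃ N : ℕ, ∀ n₀ : ℕ, N ≤ n₀ →
      ∃ (C : ℝ) (p : Polynomial ℕ), ∀ (n : ℕ) (G : SimpleGraph (Fin n)),
        Biclique.IsBalancedDecomposition G (Biclique.output n₀ G) ∧
        (2 ≤ n →
          (Biclique.complexity (Biclique.output n₀ G) : ℝ) ≤ C * ((n : ℝ) ^ 2 / Real.log (n : ℝ))) ∧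
        Biclique.runningTime n₀ G ≤ p.eval n := by
  obtain ⟨N, hN⟩ := Filter.eventually_atTop.1 Biclique.eventually_isLarge
  refine ⟨N, fun n₀ hn₀ => ?_⟩
  obtain ⟨B, hB⟩ := Biclique.exists_forall_lt_le n₀ fun _ G =>
    Biclique.complexity (Biclique.output n₀ G)
  obtain ⟨T, hT⟩ := Biclique.exists_forall_lt_le n₀ fun _ G => Biclique.runningTime n₀ G
  refine ⟨B + (2 + 16 * Real.exp 1), .C T + 100 * .X ^ 5, fun n G => ?_⟩
  have heval : (.C T + 100 * .X ^ 5 : Polynomial ℕ).eval n = T + 100 * n ^ 5 := by simp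
  rw [heval, add_mul]
  rcases lt_or_ge n n₀ with hsmall | hle
  · refine ⟨Biclique.isBalancedDecomposition_output (.inl hsmall) G, fun hn => ?_,
      le_add_right (hT n hsmall G)⟩
    have hone := Biclique.one_le_sq_div_log (x := n) (by exact_mod_cast hn)
    calc (Biclique.complexity (Biclique.output n₀ G) : ℝ) ≤ B := by exact_mod_cast hB n hsmall G
      _ ≤ B * ((n : ℝ) ^ 2 / Real.log n) := le_mul_of_one_le_right B.cast_nonneg hone
      _ ≤ _ := le_add_of_nonneg_right (by positivity)
  · have hlarge := hN n (hn₀.trans hle)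
    exact ⟨Biclique.isBalancedDecomposition_output (.inr hlarge) G,
      fun _ => (Biclique.complexity_output_le hlarge hle G).trans
        (le_add_of_nonneg_left (by positivity)),
      le_add_left (Biclique.runningTime_le hlarge hle G)⟩
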